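/- Let $p\le q$ be non-negative integers, and put $r=\frac{q-p+1}2$, $h=\frac{q+p-1}2$. Let $\mathrm B_{p,q}$ be the set of complex $p\times q$ matrices $z$ with $zz^*<1$; the radial coordinates of $z\in\mathrm B_{p,q}$ are $x_j=\lambda_j^2/(1-\lambda_j^2)$, $j=1,\dots,p$, where $\lambda_1^2,\dots,\lambda_p^2$ are the eigenvalues of $zz^*$. For $s\in\mathbb C^p$ and $x\in[0,\infty)^p$ let $$\Phi_s(x)=\Bigl(\prod_{n=0}^{p-1}n!\,(q-p+1)_n\Bigr)\,\frac{\det_{1\le k,j\le p}\bigl\{{}_2F_1(r+s_j,r-s_j;2r;-x_k)\bigr\}}{\prod_{1\le k<l\le p}(s_k^2-s_l^2)\,\prod_{1\le k<l\le p}(x_k-x_l)}$$ be the spherical function of $\mathrm U(p,q)$, given by the Berezin--Karpelevich formula and normalized by $\Phi_s(0)=1$. Here $(a)_n=a(a+1)\cdots(a+n-1)$, ${}_2F_1(\cdot\,;t)$ is, for real $t<1$, the analytic continuation of the hypergeometric series, and the quotient is extended by continuity to the points where $s_k^2=s_l^2$ or $x_k=x_l$ for some $k\ne l$. The spherical transform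 of a function $f$ of $x\in[0,\infty)^p$ is $$F(s)=\frac1{p!\,\prod_{n=0}^{p-1}n!\,(q-p+n)!}\int_{[0,\infty)^p}f(x)\,\Phi_s(x)\prod_{j=1}^p x_j^{q-p}\prod_{1\le k<l\le p}(x_k-x_l)^2\,dx_1\cdots dx_p .$$ Theorem. Let $\alpha\in\mathbb C$. (i) For every $z\in\mathrm B_{p,q}$ the radial coordinates $x_j$ are non-negative and $$\det(1-zz^*)^\alpha=\prod_{j=1}^p(1+x_j)^{-\alpha}.$$ (ii) Let $s\in\mathbb C^p$ satisfy $|\operatorname{Re}s_k|<\operatorname{Re}\alpha-h$ for $k=1,\dots,p$. Then for $f(x)=\prod_{j=1}^p(1+x_j)^{-\alpha}$ the integral that defines $F(s)$ converges absolutely, and $$F(s)=\frac{\prod_{k=1}^p\Gamma(\alpha-h+s_k)\,\Gamma(\alpha-h-s_k)}{\prod_{j=0}^{p-1}\Gamma(\alpha-j)^2}.$$ -/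

import Mathlib

open MeasureTheory Topology

/-- `F` is a real-analytic continuation of the Gauss hypergeometric series `₂F₁(a, b; c; t)`
from `-1 < t < 1` to the half-line `t < 1`. Such a continuation is unique, since the half-line
is connected; it exists if `c` is not a non-positive integer. -/
def IsHypergeometricContinuation (a b c : ℂ) (F : ℝ → ℂ) : Prop :=
  AnalyticOnNhd ℝ F (Set.Iio 1) ∧ ∀ t : ℝ, |t| < 1 → F t = ₂F₁ a b c (t : ℂ)

open Classical in
/-- The hypergeometric function `₂F₁(a, b; c; t)` for real `t < 1`: the value at `t` of the
analytic continuation of the hypergeometric series (Mathlib's `₂F₁` is the sum of the series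
only, so it says nothing for `t < -1`). -/
noncomputable def hypergeometricFun (a b c : ℂ) (t : ℝ) : ℂ :=
  if h : ∃ F : ℝ → ℂ, IsHypergeometricContinuation a b c F then h.choose t else 0

namespace MatrixBall

/-- The parameter `r = (q - p + 1) / 2`. -/
noncomputable def rParam (p q : ℕ) : ℂ := ((q : ℂ) - p + 1) / 2

/-- The parameter `h = (q + p - 1) / 2`. -/
noncomputable def hParam (p q : ℕ) : ℝ := ((q : ℝ) + p - 1) / 2

open scoped ComplexOrder in
/-- The matrix ball of complex `p × q` matrices `z` with `z z* < 1`. -/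
def ball (p q : ℕ) : Set (Matrix (Fin p) (Fin q) ℂ) :=
  {z | (1 - z * z.conjTranspose).PosDef}

/-- The radial coordinates `x_j = λ_j² / (1 - λ_j²)` of `z`, where the `λ_j²` are the eigenvalues
of `z z*`, i.e. the `λ_j` are the singular values of `z`. -/
noncomputable def radialCoord {p q : ℕ} (z : Matrix (Fin p) (Fin q) ℂ) (j : Fin p) : ℝ :=
  (Matrix.isHermitian_mul_conjTranspose_self z).eigenvalues j /
    (1 - (Matrix.isHermitian_mul_conjTranspose_self z).eigenvalues j)

/-- The product of `y_k - y_l` over all pairs `k < l`. -/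
def diffProd {R : Type*} [CommRing R] {p : ℕ} (y : Fin p → R) : R :=
  ∏ k : Fin p, ∏ l ∈ Finset.Ioi k, (y k - y l)

/-- The Berezin--Karpelevich determinant quotient, normalised by the constant (depending on `p`
and `q` only) that makes the spherical function equal to `1` at `x = 0`. It is meaningful where
both difference products are non-zero. -/
noncomputable def sphericalQuotient (p q : ℕ) (s : Fin p → ℂ) (x : Fin p → ℝ) : ℂ :=
  (∏ n ∈ Finset.range p, ((n.factorial : ℂ) * ((q - p + 1).ascFactorial n : ℂ))) *
    Matrix.det (Matrix.of fun k j : Fin p =>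
      hypergeometricFun (rParam p q + s j) (rParam p q - s j) ((q : ℂ) - p + 1) (-(x k))) /
    (diffProd (fun k => s k ^ 2) * ((diffProd x : ℝ) : ℂ))

/-- The pairs `(s, x)`, `x_k ≥ 0`, at which the denominator of the quotient does not vanish. -/
def regularSet (p : ℕ) : Set ((Fin p → ℂ) × (Fin p → ℝ)) :=
  {y | diffProd (fun k => y.1 k ^ 2) ≠ 0 ∧ diffProd y.2 ≠ 0 ∧ ∀ k, 0 ≤ y.2 k}

/-- The spherical function `Φ_s(x)` of `U(p,q)` in the radial coordinates `x`, for all `s ∈ ℂ^p`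
and `x ∈ [0,∞)^p`: the extension by continuity, over the removable singularities
`s_k² = s_l²` and `x_k = x_l`, of the determinant quotient. -/
noncomputable def sphericalFunction (p q : ℕ) (s : Fin p → ℂ) (x : Fin p → ℝ) : ℂ :=
  extendFrom (regularSet p) (fun y => sphericalQuotient p q y.1 y.2) (s, x)

/-- The density `w(x) = ∏ x_j^(q-p) ∏_{k<l} (x_k - x_l)²` of the radial part of the invariant
measure (for `p ≤ q`). -/
noncomputable def radialWeight (p q : ℕ) (x : Fin p → ℝ) : ℝ :=
  (∏ j, x j ^ (q - p)) * diffProd x ^ 2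

/-- The integrand `f(x) Φ_s(x) w(x)` of the spherical transform. -/
noncomputable def sphericalIntegrand (p q : ℕ) (f : (Fin p → ℝ) → ℂ) (s : Fin p → ℂ)
    (x : Fin p → ℝ) : ℂ :=
  f x * sphericalFunction p q s x * (radialWeight p q x : ℂ)

/-- The spherical transform of a function `f` of the radial coordinates,
`F(s) = C ∫_{x_1 ≥ 0, …, x_p ≥ 0} f(x) Φ_s(x) w(x) dx`, where the normalising constant is
`C = 1 / (p! ∏_{n<p} n! (q-p+n)!)` (this corresponds to the invariant measure
`π^(-pq) det(1 - z z*)^(-p-q) dz` on the matrix ball). -/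
noncomputable def sphericalTransform (p q : ℕ) (f : (Fin p → ℝ) → ℂ) (s : Fin p → ℂ) : ℂ :=
  ((p.factorial : ℂ) *
      ∏ n ∈ Finset.range p, ((n.factorial : ℂ) * ((q - p + n).factorial : ℂ)))⁻¹ *
    ∫ x in Set.Ici (0 : Fin p → ℝ), sphericalIntegrand p q f s x

/-- The function `∏_j (1 + x_j)^(-α)` of the radial coordinates. -/
noncomputable def berezinFunction (p : ℕ) (α : ℂ) (x : Fin p → ℝ) : ℂ :=
  ∏ j, (1 + (x j : ℂ)) ^ (-α)

end MatrixBall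

/-! Andréief's identity reduces the theorem to rank one. Put $m = q-p$. One of the two factors
$\prod_{k<l}(x_k-x_l)$ of the weight cancels the denominator of $\Phi_s$; the other is the
determinant of the powers $(1+x_k)^{p-1-i}$. The integral is therefore $p!$ times the determinant of
one-variable integrals of $x^m(1+x)^{-(\alpha-(p-1-i))}\,{}_2F_1(r+s_j,r-s_j;2r;-x)$, which are
rank-one transforms with shifted exponent. Each is a constant times
$\Gamma(\alpha-h+s_j+i)\Gamma(\alpha-h-s_j+i)/\Gamma(\alpha-(p-1-i))^2$. After the Gamma factors
with $i=0$ are taken out, a monic polynomial of degree $i$ in $-s_j^2$ remains, so the determinant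
is a Vandermonde determinant and cancels $\prod_{k<l}(s_k^2-s_l^2)$.

The rank-one integral (`integral_pow_mul_cpow_mul_jacobiFun`) is found by writing the function in
Pfaff form as a series in $x/(1+x)$, integrating termwise by the Beta integral, and summing the
result by Gauss's theorem.

Coinciding $s_k^2$ need care, because $\Phi_s$ is defined there by continuity. The hypergeometric
function is even in $s$, hence holomorphic in $z=-s^2$; its columns can be replaced by Newton
divided differences at the nodes $-s_j^2$, and the Vandermonde factor then splits off identically
(`det_hypergeometricFun`). By the maximum principle the divided differences are continuous in the
nodes and, after the growth $(1+x)^{\kappa-r}$ is removed, bounded uniformly in $x$. This gives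
absolute convergence for every $s$ in the tube and continuity of the transform in $s$, so the
formula extends from distinct $s_k^2$. Coinciding $x_k$ form a null set. -/

/-! ### Rising factorials and the Chu--Vandermonde identity -/

open Polynomial in
lemma ascPochhammer_eval_succ_left {R : Type*} [CommSemiring R] (z : R) (n : ℕ) :
    (ascPochhammer R (n + 1)).eval z = z * (ascPochhammer R n).eval (z + 1) := by
  simp [ascPochhammer_succ_left, eval_comp]

open Polynomial in
lemma ascPochhammer_eval_add {R : Type*} [CommSemiring R] (z : R) (n k : ℕ) :
    (ascPochhammer R (n + k)).eval z =
      (ascPochhammer R n).eval z * (ascPochhammer R k).eval (z + n) := by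
  simp [← ascPochhammer_mul, eval_comp]

/-- The Chu--Vandermonde identity, cleared of denominators. -/
lemma sum_choose_mul_ascPochhammer {R : Type*} [CommRing R] (N : ℕ) (c d : R) :
    ∑ n ∈ Finset.range (N + 1), (-1) ^ n * (N.choose n : R) * (ascPochhammer R n).eval d *
      (ascPochhammer R (N - n)).eval (c + n) = (ascPochhammer R N).eval (c - d) := by
  induction N generalizing c d with
  | zero => simp
  | succ N ih =>
    -- Pascal's rule splits the sum into two of length `N`, with parameters `(c, d)` and `(c + 1, d
    -- + 1)`. Both have the same `c - d`, and the factors combine to `(c + N) - d`.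
    have h1 : ∑ n ∈ Finset.range (N + 2), (-1) ^ n * ((N + 1).choose n : R) *
          (ascPochhammer R n).eval d * (ascPochhammer R (N + 1 - n)).eval (c + n) =
        (c + N) * (ascPochhammer R N).eval (c - d) -
          d * (ascPochhammer R N).eval (c - d) := by
      have h2 := ih (c + 1) (d + 1)
      rw [show c + 1 - (d + 1) = c - d by ring] at h2
      set A : ℕ → R := fun n => (-1) ^ n * (N.choose n : R) * (ascPochhammer R n).eval d *
        (ascPochhammer R (N + 1 - n)).eval (c + n) with hA
      have h3 : ∀ n ∈ Finset.range (N + 1),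
          (-1) ^ (n + 1) * ((N + 1).choose (n + 1) : R) * (ascPochhammer R (n + 1)).eval d *
            (ascPochhammer R (N + 1 - (n + 1))).eval (c + (n + 1 : ℕ)) =
          A (n + 1) - d * ((-1) ^ n * (N.choose n : R) * (ascPochhammer R n).eval (d + 1) *
            (ascPochhammer R (N - n)).eval (c + 1 + n)) := by
        intro n _
        simp only [hA]
        rw [Nat.choose_succ_succ, ascPochhammer_eval_succ_left d, Nat.add_sub_add_right,
          show c + 1 + (n : R) = c + (n + 1 : ℕ) by push_cast; ring]
        push_cast
        ring
      have h4 : ∀ n ∈ Finset.range (N + 1),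
          A n = (c + N) * ((-1) ^ n * (N.choose n : R) * (ascPochhammer R n).eval d *
            (ascPochhammer R (N - n)).eval (c + n)) := by
        intro n hn
        have hn' : n ≤ N := Nat.lt_succ_iff.mp (Finset.mem_range.mp hn)
        simp only [hA]
        rw [Nat.sub_add_comm hn', ascPochhammer_succ_eval]
        push_cast [hn']
        ring
      have h5 : ∑ n ∈ Finset.range (N + 1), A (n + 1) + A 0 =
          (c + N) * (ascPochhammer R N).eval (c - d) := by
        rw [← Finset.sum_range_succ' A (N + 1), Finset.sum_range_succ A (N + 1),
          Finset.sum_congr rfl h4, ← Finset.mul_sum, ih]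
        simp [hA]
      rw [Finset.sum_range_succ' _ (N + 1), Finset.sum_congr rfl h3, Finset.sum_sub_distrib,
        ← Finset.mul_sum, h2, ← h5]
      simp [hA]
      ring
    rw [h1, ascPochhammer_succ_eval]
    ring

/-! ### The hypergeometric and binomial series in the unit disc -/

/-- The coefficients of the hypergeometric series, as a sequence of complex numbers. -/
noncomputable abbrev hypCoeff (a b c : ℂ) (n : ℕ) : ℂ := ordinaryHypergeometricCoefficient a b c n

/-- If a parameter is a non-positive integer, the coefficients vanish from some index on (for `c`,
because of the convention `0⁻¹ = 0`) and the radius is infinite. Otherwise it is one. -/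
lemma one_le_radius_ordinaryHypergeometricSeries (a b c : ℂ) :
    1 ≤ (ordinaryHypergeometricSeries ℂ a b c).radius := by
  by_cases h : ∀ k : ℕ, (k : ℂ) ≠ -a ∧ (k : ℂ) ≠ -b ∧ (k : ℂ) ≠ -c
  · rw [ordinaryHypergeometricSeries_radius_eq_one ℂ a b c h]
  · push Not at h
    obtain ⟨k, hk⟩ := h
    by_cases ha : (k : ℂ) = -a
    · rw [show a = -(k : ℂ) by rw [ha, neg_neg], ordinaryHypergeometric_radius_top_of_neg_nat₁]
      exact le_top
    by_cases hb : (k : ℂ) = -b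
    · rw [show b = -(k : ℂ) by rw [hb, neg_neg], ordinaryHypergeometric_radius_top_of_neg_nat₂]
      exact le_top
    · rw [show c = -(k : ℂ) by rw [hk ha hb, neg_neg],
        ordinaryHypergeometric_radius_top_of_neg_nat₃]
      exact le_top

lemma mem_eball_radius_ordinaryHypergeometricSeries (a b c : ℂ) {y : ℂ} (hy : ‖y‖ < 1) :
    y ∈ Metric.eball (0 : ℂ) (ordinaryHypergeometricSeries ℂ a b c).radius := by
  rw [Metric.mem_eball, edist_zero_right]
  refine lt_of_lt_of_le ?_ (one_le_radius_ordinaryHypergeometricSeries a b c)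
  rw [← ofReal_norm, ← ENNReal.ofReal_one]
  exact (ENNReal.ofReal_lt_ofReal_iff one_pos).mpr hy

lemma summable_norm_hypCoeff_mul_pow (a b c : ℂ) {y : ℂ} (hy : ‖y‖ < 1) :
    Summable fun n => ‖hypCoeff a b c n * y ^ n‖ := by
  simpa only [ordinaryHypergeometricSeries_apply_eq, smul_eq_mul] using
    FormalMultilinearSeries.summable_norm_apply _
      (mem_eball_radius_ordinaryHypergeometricSeries a b c hy)

lemma ordinaryHypergeometric_eq_tsum_hypCoeff (a b c y : ℂ) :
    ₂F₁ a b c y = ∑' n, hypCoeff a b c n * y ^ n := by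
  simp [ordinaryHypergeometric_eq_tsum]

lemma hasSum_hypCoeff_mul_pow (a b c : ℂ) {y : ℂ} (hy : ‖y‖ < 1) :
    HasSum (fun n => hypCoeff a b c n * y ^ n) (₂F₁ a b c y) := by
  rw [ordinaryHypergeometric_eq_tsum_hypCoeff]
  exact (summable_norm_hypCoeff_mul_pow a b c hy).of_norm.hasSum

lemma analyticAt_ordinaryHypergeometric (a b c : ℂ) {y : ℂ} (hy : ‖y‖ < 1) :
    AnalyticAt ℂ (₂F₁ a b c : ℂ → ℂ) y := by
  have h := (ordinaryHypergeometricSeries ℂ a b c).hasFPowerSeriesOnBall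
    (lt_of_lt_of_le one_pos (one_le_radius_ordinaryHypergeometricSeries a b c))
  exact h.analyticAt_of_mem (mem_eball_radius_ordinaryHypergeometricSeries a b c hy)

lemma hasSum_one_sub_cpow_neg (z : ℂ) {t : ℂ} (ht : ‖t‖ < 1) :
    HasSum (fun n : ℕ => (ascPochhammer ℂ n).eval z / n.factorial * t ^ n) ((1 - t) ^ (-z)) := by
  have h := (Complex.one_add_cpow_hasFPowerSeriesOnBall_zero (a := -z)).hasSum (y := -t)
    (by
      rw [Metric.mem_eball, edist_zero_right, ← ofReal_norm, norm_neg, ← ENNReal.ofReal_one]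
      exact (ENNReal.ofReal_lt_ofReal_iff one_pos).mpr ht)
  -- The binomial series is `₂F₁(z, b; b; t)` for any admissible `b`; with `b = 1` no denominator
  -- vanishes.
  rw [binomialSeries_eq_ordinaryHypergeometricSeries (b := (1 : ℂ))
    (fun k hk => by
      have h2 : ((k + 1 : ℕ) : ℂ) = 0 := by push_cast; rw [hk]; ring
      exact Nat.cast_ne_zero.mpr (Nat.succ_ne_zero k) h2)] at h
  have h3 : (fun n : ℕ => (ascPochhammer ℂ n).eval z / n.factorial * t ^ n) =
      fun n => ((ordinaryHypergeometricSeries ℂ (- -z) 1 1).compContinuousLinearMap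
        (-ContinuousLinearMap.id ℂ ℂ) n) fun _ => -t := by
    funext n
    have h1 : (ascPochhammer ℂ n).eval (1 : ℂ) ≠ 0 := by
      rw [ascPochhammer_eval_one]; exact_mod_cast n.factorial_ne_zero
    rw [FormalMultilinearSeries.compContinuousLinearMap_apply]
    simp only [Function.comp_def, neg_apply, ContinuousLinearMap.id_apply,
      neg_neg, ordinaryHypergeometricSeries_apply_eq, smul_eq_mul]
    field_simp
  rw [h3]
  simpa [sub_eq_add_neg] using h

/-! ### Pfaff's transformation -/

/-- The double series behind Pfaff's transformation. -/
noncomputable def pfaffTerm (a b c t : ℂ) (x : ℕ × ℕ) : ℂ :=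
  hypCoeff (c - a) b c x.1 * (-t) ^ x.1 *
    ((ascPochhammer ℂ x.2).eval (b + x.1) / x.2.factorial * t ^ x.2)

lemma norm_ascPochhammer_eval_le (z : ℂ) (n : ℕ) :
    ‖(ascPochhammer ℂ n).eval z‖ ≤ (ascPochhammer ℝ n).eval ‖z‖ := by
  induction n with
  | zero => simp
  | succ n ih =>
    rw [ascPochhammer_succ_eval, ascPochhammer_succ_eval, norm_mul]
    refine mul_le_mul ih ((norm_add_le _ _).trans (by simp)) (norm_nonneg _)
      ((norm_nonneg _).trans ih)

lemma ascPochhammer_eval_mono {x y : ℝ} (hx : 0 ≤ x) (hxy : x ≤ y) (n : ℕ) :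
    0 ≤ (ascPochhammer ℝ n).eval x ∧ (ascPochhammer ℝ n).eval x ≤ (ascPochhammer ℝ n).eval y := by
  induction n with
  | zero => simp
  | succ n ih =>
    rw [ascPochhammer_succ_eval, ascPochhammer_succ_eval]
    have hn : (0 : ℝ) ≤ n := n.cast_nonneg
    exact ⟨mul_nonneg ih.1 (by linarith),
      mul_le_mul ih.2 (by linarith) (by linarith) (ih.1.trans ih.2)⟩

lemma hasSum_one_sub_rpow_neg {z t : ℝ} (ht : |t| < 1) :
    HasSum (fun n : ℕ => (ascPochhammer ℝ n).eval z / n.factorial * t ^ n) ((1 - t) ^ (-z)) := by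
  have h := hasSum_one_sub_cpow_neg (z : ℂ) (t := (t : ℂ)) (by simpa using ht)
  have h0 : 0 ≤ 1 - t := by linarith [(abs_lt.mp ht).2]
  rw [← Complex.hasSum_ofReal]
  convert h using 2
  · rename_i n
    have : (((ascPochhammer ℝ n).eval z : ℝ) : ℂ) = (ascPochhammer ℂ n).eval (z : ℂ) := by
      rw [← ascPochhammer_map Complex.ofRealHom, Polynomial.eval_map]
      exact (Polynomial.eval₂_at_apply Complex.ofRealHom z).symm
    push_cast
    rw [this]
  · rw [Complex.ofReal_cpow h0]
    simp

/-- With `b + n` replaced by `‖b‖ + n`, the inner sum is `(1 - ‖t‖) ^ (-(‖b‖ + n))`. What remains is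
a hypergeometric series at `‖t‖ / (1 - ‖t‖)`, which is less than one exactly when `‖t‖ < 1 / 2`. -/
lemma summable_norm_pfaffTerm (a b c : ℂ) {t : ℂ} (ht : ‖t‖ < 1 / 2) :
    Summable fun x => ‖pfaffTerm a b c t x‖ := by
  have h1 : |‖t‖| < 1 := by rw [abs_norm]; linarith
  have hp : 0 < 1 - ‖t‖ := by linarith
  have hin : ∀ n : ℕ, HasSum (fun k : ℕ => ‖hypCoeff (c - a) b c n * (-t) ^ n‖ *
      ((ascPochhammer ℝ k).eval (‖b‖ + n) / k.factorial * ‖t‖ ^ k))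
      (‖hypCoeff (c - a) b c n * (-t) ^ n‖ * (1 - ‖t‖) ^ (-(‖b‖ + n))) := fun n =>
    (hasSum_one_sub_rpow_neg h1).mul_left _
  have hle : ∀ x : ℕ × ℕ, ‖pfaffTerm a b c t x‖ ≤ ‖hypCoeff (c - a) b c x.1 * (-t) ^ x.1‖ *
      ((ascPochhammer ℝ x.2).eval (‖b‖ + x.1) / x.2.factorial * ‖t‖ ^ x.2) := by
    intro x
    rw [pfaffTerm, norm_mul]
    refine mul_le_mul_of_nonneg_left ?_ (norm_nonneg _)
    rw [norm_mul, norm_div, norm_pow, Complex.norm_natCast]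
    gcongr
    refine (norm_ascPochhammer_eval_le _ _).trans
      (ascPochhammer_eval_mono (norm_nonneg _) ?_ _).2
    exact (norm_add_le _ _).trans (by simp)
  refine Summable.of_nonneg_of_le (fun _ => norm_nonneg _) hle ?_
  refine (summable_prod_of_nonneg fun x => (norm_nonneg _).trans (hle x)).mpr
    ⟨fun n => (hin n).summable, ?_⟩
  simp only [(hin _).tsum_eq]
  have hy : ‖(((‖t‖ / (1 - ‖t‖) : ℝ)) : ℂ)‖ < 1 := by
    rw [Complex.norm_real, Real.norm_eq_abs, abs_of_nonneg (by positivity), div_lt_one hp]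
    linarith
  refine ((summable_norm_hypCoeff_mul_pow (c - a) b c hy).mul_right
    ((1 - ‖t‖) ^ (-‖b‖))).congr fun n => ?_
  rw [neg_add, Real.rpow_add hp, Real.rpow_neg hp.le (n : ℝ), Real.rpow_natCast]
  simp only [norm_mul, norm_pow, norm_neg, Complex.norm_real, Real.norm_eq_abs,
    abs_of_nonneg (div_nonneg (norm_nonneg t) hp.le), div_pow]
  field_simp

-- Collecting the coefficient of `t ^ N` leaves the Chu--Vandermonde sum with parameters `c` and `c
-- - a`, whose value is the rising factorial of `a`.
open Finset.HasAntidiagonal in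
lemma sum_antidiagonal_pfaffTerm (a b c t : ℂ) (hc : ∀ n, (ascPochhammer ℂ n).eval c ≠ 0) (N : ℕ) :
    ∑ x ∈ antidiagonal N, pfaffTerm a b c t x = hypCoeff a b c N * t ^ N := by
  have hf : ∀ n : ℕ, (n.factorial : ℂ) ≠ 0 := fun n => by exact_mod_cast n.factorial_ne_zero
  have key := sum_choose_mul_ascPochhammer N c (c - a)
  rw [sub_sub_cancel] at key
  rw [Finset.Nat.sum_antidiagonal_eq_sum_range_succ_mk]
  have h1 : ∀ n ∈ Finset.range N.succ, pfaffTerm a b c t (n, N - n) =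
      ((ascPochhammer ℂ N).eval b * t ^ N / (N.factorial * (ascPochhammer ℂ N).eval c)) *
      ((-1) ^ n * (N.choose n : ℂ) * (ascPochhammer ℂ n).eval (c - a) *
        (ascPochhammer ℂ (N - n)).eval (c + n)) := by
    intro n hn
    obtain ⟨k, rfl⟩ := Nat.exists_eq_add_of_le (Nat.lt_succ_iff.mp (Finset.mem_range.mp hn))
    have hch : ((n + k).choose n : ℂ) = (n + k).factorial / (n.factorial * k.factorial) := by
      rw [eq_div_iff (mul_ne_zero (hf _) (hf _)), ← mul_assoc]
      rw [Nat.choose_symm_add]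
      exact_mod_cast Nat.add_choose_mul_factorial_mul_factorial n k
    have hcn := hc n
    have hcN := hc (n + k)
    rw [ascPochhammer_eval_add] at hcN
    rw [pfaffTerm, Nat.add_sub_cancel_left, hch, ascPochhammer_eval_add b, ascPochhammer_eval_add c,
      neg_pow, pow_add, hypCoeff, ordinaryHypergeometricCoefficient]
    have hck := right_ne_zero_of_mul hcN
    have := hf n
    have := hf k
    have := hf (n + k)
    field_simp
  rw [Finset.sum_congr rfl h1, ← Finset.mul_sum, key, hypCoeff, ordinaryHypergeometricCoefficient]
  have := hf N
  have := hc N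
  field_simp

/-- **Pfaff's transformation** near the origin. -/
lemma pfaff_of_norm_lt_half (a b c : ℂ) (hc : ∀ n, (ascPochhammer ℂ n).eval c ≠ 0) {t : ℂ}
    (ht : ‖t‖ < 1 / 2) :
    (1 - t) ^ (-b) * ₂F₁ (c - a) b c (t / (t - 1)) = ₂F₁ a b c t := by
  have hs := (summable_norm_pfaffTerm a b c ht).of_norm
  have h1 : ‖t‖ < 1 := by linarith
  have hne : 1 - t ≠ 0 := by
    intro h
    rw [← sub_eq_zero.mp h, norm_one] at h1
    exact lt_irrefl _ h1
  have hy : ‖t / (t - 1)‖ < 1 := by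
    rw [norm_div, div_lt_one (norm_pos_iff.mpr (by rwa [← neg_sub, neg_ne_zero]))]
    have : ‖(1 : ℂ)‖ ≤ ‖t‖ + ‖t - 1‖ := by
      rw [show (1 : ℂ) = t - (t - 1) by ring]
      simpa using norm_sub_le t (t - 1)
    rw [norm_one] at this
    linarith
  have hrow : ∀ n : ℕ, HasSum (fun k => pfaffTerm a b c t (n, k))
      ((1 - t) ^ (-b) * (hypCoeff (c - a) b c n * (t / (t - 1)) ^ n)) := by
    intro n
    have h := (hasSum_one_sub_cpow_neg (b + n) h1).mul_left (hypCoeff (c - a) b c n * (-t) ^ n)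
    suffices e : (1 - t) ^ (-b) * (hypCoeff (c - a) b c n * (t / (t - 1)) ^ n) =
        hypCoeff (c - a) b c n * (-t) ^ n * (1 - t) ^ (-(b + n)) by
      rw [e]
      exact h
    rw [neg_add, Complex.cpow_add _ _ hne, Complex.cpow_neg _ (n : ℂ), Complex.cpow_natCast,
      ← neg_sub 1 t, div_neg, ← neg_div, div_pow]
    field_simp
  -- The same double series is summed by rows, giving the Pfaff side, and by antidiagonals, giving
  -- the original series.
  have hA := hs.hasSum.prod_fiberwise hrow
  have hB := (hasSum_hypCoeff_mul_pow (c - a) b c hy).mul_left ((1 - t) ^ (-b))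
  rw [hB.unique hA, ← (Finset.HasAntidiagonal.sigmaAntidiagonalEquivProd (A := ℕ)).tsum_eq,
    Summable.tsum_sigma'
      (f := fun x => pfaffTerm a b c t (Finset.HasAntidiagonal.sigmaAntidiagonalEquivProd x))
      (fun n => (hasSum_fintype _).summable)
      ((Finset.HasAntidiagonal.sigmaAntidiagonalEquivProd (A := ℕ)).summable_iff.mpr hs),
    ordinaryHypergeometric_eq_tsum_hypCoeff]
  refine tsum_congr fun N => ?_
  rw [← sum_antidiagonal_pfaffTerm a b c t hc N, tsum_fintype]
  exact Finset.sum_coe_sort _ (pfaffTerm a b c t)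

/-! ### Analytic continuation to the half-line -/

/-- The Pfaff form of the hypergeometric function. -/
noncomputable def pfaffForm (a b c : ℂ) (t : ℝ) : ℂ :=
  (1 - (t : ℂ)) ^ (-b) * ₂F₁ (c - a) b c ((t : ℂ) / (t - 1))

lemma analyticAt_ordinaryHypergeometric_ofReal (a b c : ℂ) {t : ℝ} (ht : |t| < 1) :
    AnalyticAt ℝ (fun t : ℝ => ₂F₁ a b c (t : ℂ)) t :=
  ((analyticAt_ordinaryHypergeometric a b c (y := (t : ℂ)) (by simpa using ht)).restrictScalars
    (𝕜 := ℝ)).comp (Complex.ofRealCLM.analyticAt t)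

lemma analyticAt_pfaffForm (a b c : ℂ) {t : ℝ} (ht : t < 1 / 2) :
    AnalyticAt ℝ (pfaffForm a b c) t := by
  have h1 : (t : ℂ) - 1 ≠ 0 := by
    have : ((t - 1 : ℝ) : ℂ) ≠ 0 := by exact_mod_cast (by linarith : t - 1 < 0).ne
    simpa using this
  have hy : ‖(t : ℂ) / (t - 1)‖ < 1 := by
    rw [← Complex.ofReal_one, ← Complex.ofReal_sub, ← Complex.ofReal_div, Complex.norm_real,
      Real.norm_eq_abs, abs_div, div_lt_one (abs_pos.mpr (by linarith)),
      abs_of_neg (by linarith : t - 1 < 0)]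
    exact abs_lt.mpr ⟨by linarith, by linarith⟩
  have h2 : AnalyticAt ℂ (fun z : ℂ => (1 - z) ^ (-b) * ₂F₁ (c - a) b c (z / (z - 1))) (t : ℂ) := by
    refine AnalyticAt.mul (AnalyticAt.cpow (by fun_prop) (by fun_prop) ?_) ?_
    · rw [← Complex.ofReal_one, ← Complex.ofReal_sub]
      exact Complex.ofReal_mem_slitPlane.mpr (by linarith)
    · have h3 : AnalyticAt ℂ (fun z : ℂ => z / (z - 1)) (t : ℂ) :=
        AnalyticAt.div (by fun_prop) (by fun_prop) h1
      exact AnalyticAt.comp (g := (₂F₁ (c - a) b c : ℂ → ℂ))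
        (analyticAt_ordinaryHypergeometric (c - a) b c hy) h3
  exact (h2.restrictScalars (𝕜 := ℝ)).comp (Complex.ofRealCLM.analyticAt t)

lemma pfaffForm_eq (a b c : ℂ) (hc : ∀ n, (ascPochhammer ℂ n).eval c ≠ 0) {t : ℝ}
    (ht : t ∈ Set.Ioo (-1 : ℝ) (1 / 2)) : pfaffForm a b c t = ₂F₁ a b c (t : ℂ) := by
  have hA : AnalyticOnNhd ℝ (pfaffForm a b c) (Set.Ioo (-1 : ℝ) (1 / 2)) :=
    fun t ht => analyticAt_pfaffForm a b c ht.2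
  have hB : AnalyticOnNhd ℝ (fun t : ℝ => ₂F₁ a b c (t : ℂ)) (Set.Ioo (-1 : ℝ) (1 / 2)) :=
    fun t ht => analyticAt_ordinaryHypergeometric_ofReal a b c
      (abs_lt.mpr ⟨ht.1, ht.2.trans (by norm_num)⟩)
  refine hA.eqOn_of_preconnected_of_eventuallyEq hB isPreconnected_Ioo
    (show (0 : ℝ) ∈ Set.Ioo (-1 : ℝ) (1 / 2) by norm_num) ?_ ht
  filter_upwards [Metric.ball_mem_nhds (0 : ℝ) (by norm_num : (0 : ℝ) < 1 / 2)] with u hu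
  exact pfaff_of_norm_lt_half a b c hc (by simpa using hu)

/-- Two analytic pieces are glued: the Pfaff form, analytic for `t < 1 / 2` because `|t / (t - 1)| <
1` there, and the series on `|t| < 1`. They agree on the overlap by the identity theorem. -/
lemma exists_isHypergeometricContinuation (a b c : ℂ)
    (hc : ∀ n, (ascPochhammer ℂ n).eval c ≠ 0) :
    ∃ F, IsHypergeometricContinuation a b c F ∧ ∀ t < 1 / 2, F t = pfaffForm a b c t := by
  have hser : ∀ t : ℝ, |t| < 1 →
      (if t < 1 / 2 then pfaffForm a b c t else ₂F₁ a b c (t : ℂ)) = ₂F₁ a b c (t : ℂ) := by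
    intro t ht
    split_ifs with h
    · exact pfaffForm_eq a b c hc ⟨(abs_lt.mp ht).1, h⟩
    · rfl
  refine ⟨fun t => if t < 1 / 2 then pfaffForm a b c t else ₂F₁ a b c (t : ℂ), ⟨?_, hser⟩,
    fun t ht => if_pos ht⟩
  intro t ht
  by_cases h : t < 1 / 2
  · refine (analyticAt_pfaffForm a b c h).congr ?_
    filter_upwards [Iio_mem_nhds h] with u hu
    exact (if_pos hu).symm
  · have h1 : |t| < 1 := abs_lt.mpr ⟨by linarith, ht⟩
    refine (analyticAt_ordinaryHypergeometric_ofReal a b c h1).congr ?_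
    filter_upwards [continuous_abs.continuousAt.eventually_lt continuousAt_const h1] with u hu
    exact (hser u hu).symm

lemma isHypergeometricContinuation_unique {a b c : ℂ} {F G : ℝ → ℂ}
    (hF : IsHypergeometricContinuation a b c F) (hG : IsHypergeometricContinuation a b c G)
    {t : ℝ} (ht : t < 1) : F t = G t := by
  refine hF.1.eqOn_of_preconnected_of_eventuallyEq hG.1 isPreconnected_Iio
    (show (0 : ℝ) ∈ Set.Iio 1 by norm_num) ?_ ht
  filter_upwards [Metric.ball_mem_nhds (0 : ℝ) one_pos] with u hu
  have hu' : |u| < 1 := by simpa using hu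
  rw [hF.2 u hu', hG.2 u hu']

lemma hypergeometricFun_eq_of_isHypergeometricContinuation {a b c : ℂ} {F : ℝ → ℂ}
    (hF : IsHypergeometricContinuation a b c F) {t : ℝ} (ht : t < 1) :
    hypergeometricFun a b c t = F t := by
  have h : ∃ F, IsHypergeometricContinuation a b c F := ⟨F, hF⟩
  rw [hypergeometricFun, dif_pos h]
  exact isHypergeometricContinuation_unique h.choose_spec hF ht

lemma hypergeometricFun_eq_pfaffForm (a b c : ℂ) (hc : ∀ n, (ascPochhammer ℂ n).eval c ≠ 0)
    {t : ℝ} (ht : t < 1 / 2) : hypergeometricFun a b c t = pfaffForm a b c t := by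
  obtain ⟨F, hF, h⟩ := exists_isHypergeometricContinuation a b c hc
  rw [hypergeometricFun_eq_of_isHypergeometricContinuation hF (by linarith), h t ht]

lemma hypergeometricFun_symm (a b c : ℂ) (t : ℝ) :
    hypergeometricFun a b c t = hypergeometricFun b a c t := by
  have h0 : ordinaryHypergeometricSeries ℂ a b c = ordinaryHypergeometricSeries ℂ b a c :=
    ordinaryHypergeometricSeries_symm a b c
  have : IsHypergeometricContinuation a b c = IsHypergeometricContinuation b a c := by
    funext F
    simp only [IsHypergeometricContinuation, ordinaryHypergeometric, h0]
  unfold hypergeometricFun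
  rw [this]

/-! ### The rank-one spherical function: growth and regularity -/

/-- The Pfaff form of `₂F₁(r + s, r - s; 2r; -x)` with `2r = m + 1`. -/
noncomputable def jacobiFun (m : ℕ) (s : ℂ) (x : ℝ) : ℂ :=
  (1 + (x : ℂ)) ^ (s - (m + 1) / 2) *
    ₂F₁ ((m + 1) / 2 - s) ((m + 1) / 2 - s) (m + 1) ((x : ℂ) / (1 + x))

lemma ascPochhammer_eval_natCast_add_one (m n : ℕ) :
    (ascPochhammer ℂ n).eval ((m : ℂ) + 1) = ((ascPochhammer ℝ n).eval ((m : ℝ) + 1) : ℝ) := by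
  have h1 := ascPochhammer_nat_eq_natCast_ascFactorial ℂ (m + 1) n
  have h2 := ascPochhammer_nat_eq_natCast_ascFactorial ℝ (m + 1) n
  push_cast at h1 h2
  rw [h1, h2]
  simp

lemma ascPochhammer_eval_pos {z : ℝ} (hz : 0 < z) (n : ℕ) : 0 < (ascPochhammer ℝ n).eval z :=
  ascPochhammer_pos n z hz

lemma ascPochhammer_eval_natCast_add_one_ne_zero (m n : ℕ) :
    (ascPochhammer ℂ n).eval ((m : ℂ) + 1) ≠ 0 := by
  rw [ascPochhammer_eval_natCast_add_one]
  exact Complex.ofReal_ne_zero.mpr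
    (ascPochhammer_eval_pos (by positivity : 0 < (m : ℝ) + 1) n).ne'

lemma hypergeometricFun_eq_jacobiFun (m : ℕ) (s : ℂ) {x : ℝ} (hx : 0 ≤ x) :
    hypergeometricFun ((m + 1) / 2 + s) ((m + 1) / 2 - s) (m + 1) (-x) = jacobiFun m s x := by
  have h1 : (1 : ℂ) + x ≠ 0 := by
    have : ((1 + x : ℝ) : ℂ) ≠ 0 := by exact_mod_cast (by linarith : 0 < 1 + x).ne'
    simpa using this
  rw [hypergeometricFun_eq_pfaffForm _ _ _ (ascPochhammer_eval_natCast_add_one_ne_zero m)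
    (by linarith), pfaffForm, jacobiFun]
  congr 2
  · push_cast; ring
  · ring
  · ring
  · rw [Complex.ofReal_neg, show -(x : ℂ) - 1 = -(1 + x) by ring, neg_div_neg_eq]

/-- In the Pfaff form this is Euler's transformation; on the continued function it is the symmetry
of the two numerator parameters. It reduces the estimates to `0 ≤ s.re`. -/
lemma jacobiFun_neg (m : ℕ) (s : ℂ) {x : ℝ} (hx : 0 ≤ x) :
    jacobiFun m (-s) x = jacobiFun m s x := by
  rw [← hypergeometricFun_eq_jacobiFun m _ hx, ← hypergeometricFun_eq_jacobiFun m _ hx,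
    hypergeometricFun_symm, sub_neg_eq_add, ← sub_eq_add_neg]

/-- Let `r = (m + 1) / 2`. For `0 ≤ s.re` each new factor on the left is at most `(n + 1 + r)² +
R²`, which exceeds `(n + 1)(n + 1 + 2r)` by `K = r² + R²`. The relative excess is at most `K
(1/(n+1) - 1/(n+2))`; it telescopes inside the exponential, so the constant stays bounded in `n`. -/
lemma sq_norm_ascPochhammer_le (m : ℕ) {R : ℝ} {s : ℂ} (hs : 0 ≤ s.re) (hR : ‖s‖ ≤ R) (n : ℕ) :
    ‖(ascPochhammer ℂ (n + 1)).eval (((m : ℂ) + 1) / 2 - s)‖ ^ 2 ≤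
      (((m : ℝ) + 1) / 2 + R) ^ 2 *
        Real.exp (((((m : ℝ) + 1) / 2) ^ 2 + R ^ 2) * (1 - 1 / ((n : ℝ) + 1))) *
        ((ascPochhammer ℝ (n + 1)).eval ((m : ℝ) + 1) * n.factorial) := by
  set r : ℝ := ((m : ℝ) + 1) / 2 with hr
  have hr0 : 0 < r := by positivity
  have hrc : ((m : ℂ) + 1) / 2 = (r : ℂ) := by rw [hr]; push_cast; ring
  have hm : (m : ℝ) + 1 = 2 * r := by rw [hr]; ring
  have hR0 : 0 ≤ R := (norm_nonneg s).trans hR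
  rw [hrc]
  induction n with
  | zero =>
    have h1 : ‖(r : ℂ) - s‖ ≤ r + R := by
      refine (norm_sub_le _ _).trans ?_
      rw [Complex.norm_real, Real.norm_eq_abs, abs_of_pos hr0]
      linarith
    have h2 : ‖(r : ℂ) - s‖ ^ 2 ≤ (r + R) ^ 2 := pow_le_pow_left₀ (norm_nonneg _) h1 2
    have h3 : (1 : ℝ) ≤ (m : ℝ) + 1 := by linarith [(m.cast_nonneg : (0 : ℝ) ≤ m)]
    simp only [zero_add, ascPochhammer_one, Polynomial.eval_X, Nat.cast_zero, div_one, sub_self,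
      mul_zero, Real.exp_zero, mul_one, Nat.factorial_zero, Nat.cast_one]
    nlinarith [sq_nonneg (r + R)]
  | succ n ih =>
    set K := r ^ 2 + R ^ 2
    have hn : (0 : ℝ) < (n : ℝ) + 1 := by positivity
    have hsq : ‖(r : ℂ) - s + (n + 1 : ℕ)‖ ^ 2 ≤ ((n : ℝ) + 1 + r) ^ 2 + R ^ 2 := by
      have h1 : ‖s‖ ^ 2 ≤ R ^ 2 := pow_le_pow_left₀ (norm_nonneg _) hR 2
      rw [← Complex.normSq_eq_norm_sq, Complex.normSq_apply] at h1 ⊢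
      simp
      nlinarith [mul_nonneg hs (by positivity : 0 ≤ (n : ℝ) + 1 + r)]
    have hexp : K * (1 / ((n : ℝ) + 1) - 1 / ((n : ℝ) + 1 + 1)) + 1 ≤
        Real.exp (K * (1 / ((n : ℝ) + 1) - 1 / ((n : ℝ) + 1 + 1))) := Real.add_one_le_exp _
    have hfac : ((n : ℝ) + 1 + r) ^ 2 + R ^ 2 ≤ ((n : ℝ) + 1) * ((m : ℝ) + 1 + (n + 1 : ℕ)) *
        Real.exp (K * (1 / ((n : ℝ) + 1) - 1 / ((n : ℝ) + 1 + 1))) := by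
      have h0 : 0 ≤ ((n : ℝ) + 1) * ((m : ℝ) + 1 + (n + 1 : ℕ)) := by positivity
      refine le_trans ?_ (mul_le_mul_of_nonneg_left hexp h0)
      have h1 : ((n : ℝ) + 1) * ((m : ℝ) + 1 + (n + 1 : ℕ)) *
          (K * (1 / ((n : ℝ) + 1) - 1 / ((n : ℝ) + 1 + 1)) + 1) =
          ((n : ℝ) + 1) * ((m : ℝ) + 1 + (n + 1 : ℕ)) +
            K * (((m : ℝ) + (n + 2)) / ((n : ℝ) + 2)) := by
        push_cast
        field_simp
        ring
      have h2 : 1 ≤ ((m : ℝ) + (n + 2)) / ((n : ℝ) + 2) := by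
        rw [le_div_iff₀ (by positivity)]
        linarith [(m.cast_nonneg : (0 : ℝ) ≤ m)]
      have hK : 0 ≤ K := by positivity
      rw [h1, hm]
      push_cast
      nlinarith [mul_le_mul_of_nonneg_left h2 hK]
    rw [ascPochhammer_succ_eval, norm_mul, mul_pow]
    refine (mul_le_mul ih (hsq.trans hfac) (sq_nonneg _) ?_).trans_eq ?_
    · have := (ascPochhammer_eval_pos (by positivity : 0 < (m : ℝ) + 1) (n + 1)).le
      positivity
    · rw [ascPochhammer_succ_eval (n + 1), Nat.factorial_succ,
        show K * (1 - 1 / (((n + 1 : ℕ) : ℝ) + 1)) = K * (1 - 1 / ((n : ℝ) + 1)) +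
          K * (1 / ((n : ℝ) + 1) - 1 / ((n : ℝ) + 1 + 1)) by push_cast; ring, Real.exp_add]
      push_cast
      ring

lemma norm_hypCoeff_jacobi (m : ℕ) (s : ℂ) (n : ℕ) :
    ‖hypCoeff ((m + 1) / 2 - s) ((m + 1) / 2 - s) (m + 1) n‖ =
      ‖(ascPochhammer ℂ n).eval (((m : ℂ) + 1) / 2 - s)‖ ^ 2 /
        (n.factorial * (ascPochhammer ℝ n).eval ((m : ℝ) + 1)) := by
  rw [hypCoeff, ordinaryHypergeometricCoefficient, ascPochhammer_eval_natCast_add_one]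
  simp only [norm_mul, norm_inv, Complex.norm_natCast, Complex.norm_real, Real.norm_eq_abs,
    abs_of_pos (ascPochhammer_eval_pos (by positivity : 0 < (m : ℝ) + 1) n)]
  have := (ascPochhammer_eval_pos (by positivity : 0 < (m : ℝ) + 1) n).ne'
  field_simp

/-- The constant in the bound on the coefficients of the Pfaff form. -/
noncomputable def jacobiCoeffBound (m : ℕ) (R : ℝ) : ℝ :=
  (((m : ℝ) + 1) / 2 + R) ^ 2 * Real.exp ((((m : ℝ) + 1) / 2) ^ 2 + R ^ 2)

lemma jacobiCoeffBound_nonneg (m : ℕ) (R : ℝ) : 0 ≤ jacobiCoeffBound m R := by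
  unfold jacobiCoeffBound; positivity

lemma norm_hypCoeff_jacobi_succ_le (m : ℕ) {R : ℝ} {s : ℂ} (hs : 0 ≤ s.re) (hR : ‖s‖ ≤ R)
    (n : ℕ) :
    ‖hypCoeff ((m + 1) / 2 - s) ((m + 1) / 2 - s) (m + 1) (n + 1)‖ ≤
      jacobiCoeffBound m R / ((n : ℝ) + 1) := by
  have hp := ascPochhammer_eval_pos (by positivity : 0 < (m : ℝ) + 1) (n + 1)
  rw [norm_hypCoeff_jacobi, Nat.factorial_succ, div_le_div_iff₀ (by positivity) (by positivity)]
  have h1 := sq_norm_ascPochhammer_le m hs hR n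
  have h2 : Real.exp (((((m : ℝ) + 1) / 2) ^ 2 + R ^ 2) * (1 - 1 / ((n : ℝ) + 1))) ≤
      Real.exp ((((m : ℝ) + 1) / 2) ^ 2 + R ^ 2) := by
    refine Real.exp_le_exp.mpr (mul_le_of_le_one_right (by positivity) ?_)
    have : 0 ≤ 1 / ((n : ℝ) + 1) := by positivity
    linarith
  have h3 := h1.trans (mul_le_mul_of_nonneg_right (mul_le_mul_of_nonneg_left h2
    (sq_nonneg (((m : ℝ) + 1) / 2 + R)))
    (by positivity : 0 ≤ (ascPochhammer ℝ (n + 1)).eval ((m : ℝ) + 1) * n.factorial))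
  refine (mul_le_mul_of_nonneg_right h3 (by positivity : 0 ≤ (n : ℝ) + 1)).trans_eq ?_
  rw [jacobiCoeffBound]
  push_cast
  ring

lemma hasSum_pow_div_log_one_add {x : ℝ} (hx : 0 ≤ x) :
    HasSum (fun n : ℕ => (x / (1 + x)) ^ (n + 1) / ((n : ℝ) + 1)) (Real.log (1 + x)) := by
  have h1 : 0 < 1 + x := by linarith
  have h := Real.hasSum_pow_div_log_of_abs_lt_one (x := x / (1 + x))
    (by rw [abs_of_nonneg (by positivity), div_lt_one h1]; linarith)
  rwa [show 1 - x / (1 + x) = (1 + x)⁻¹ by field_simp; ring, Real.log_inv, neg_neg] at h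

lemma norm_ofReal_div_one_add {x : ℝ} (hx : 0 ≤ x) : ‖(x : ℂ) / (1 + x)‖ = x / (1 + x) := by
  rw [← Complex.ofReal_one, ← Complex.ofReal_add, ← Complex.ofReal_div, Complex.norm_real,
    Real.norm_eq_abs, abs_of_nonneg (by positivity)]

lemma div_one_add_lt_one {x : ℝ} (hx : 0 ≤ x) : x / (1 + x) < 1 := by
  rw [div_lt_one (by linarith)]; linarith

lemma norm_one_add_cpow {x : ℝ} (hx : 0 ≤ x) (z : ℂ) : ‖(1 + (x : ℂ)) ^ z‖ = (1 + x) ^ z.re := by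
  rw [← Complex.ofReal_one, ← Complex.ofReal_add,
    Complex.norm_cpow_eq_rpow_re_of_pos (by linarith)]

/-- The coefficients are `O(1/n)`, and `∑ yⁿ / n` at `y = x / (1 + x)` is `log (1 + x)`. -/
lemma norm_jacobi_series_le (m : ℕ) {R : ℝ} {s : ℂ} (hs : 0 ≤ s.re) (hR : ‖s‖ ≤ R) {x : ℝ}
    (hx : 0 ≤ x) :
    ‖₂F₁ ((m + 1) / 2 - s) ((m + 1) / 2 - s) (m + 1) ((x : ℂ) / (1 + x))‖ ≤
      1 + jacobiCoeffBound m R * Real.log (1 + x) := by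
  have hy : ‖(x : ℂ) / (1 + x)‖ < 1 := by
    rw [norm_ofReal_div_one_add hx]; exact div_one_add_lt_one hx
  have hs0 := summable_norm_hypCoeff_mul_pow ((m + 1) / 2 - s) ((m + 1) / 2 - s) (m + 1) hy
  rw [ordinaryHypergeometric_eq_tsum_hypCoeff]
  refine (norm_tsum_le_tsum_norm hs0).trans ?_
  rw [hs0.tsum_eq_zero_add]
  refine add_le_add (by simp [hypCoeff, ordinaryHypergeometricCoefficient]) ?_
  refine hasSum_le (fun n => ?_) ((summable_nat_add_iff 1).mpr hs0).hasSum
    ((hasSum_pow_div_log_one_add hx).mul_left (jacobiCoeffBound m R))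
  rw [norm_mul, norm_pow, norm_ofReal_div_one_add hx, mul_div_assoc', ← div_mul_eq_mul_div]
  exact mul_le_mul_of_nonneg_right (norm_hypCoeff_jacobi_succ_le m hs hR n) (by positivity)

/-- The logarithm costs an arbitrarily small power `ε`, and evenness in `s` accounts for `|s.re|`.
One constant serves all `s` in a disc. -/
lemma exists_norm_jacobiFun_le (m : ℕ) (R : ℝ) {ε : ℝ} (hε : 0 < ε) :
    ∃ C, 0 ≤ C ∧ ∀ s : ℂ, ‖s‖ ≤ R → ∀ x : ℝ, 0 ≤ x →
      ‖jacobiFun m s x‖ ≤ C * (1 + x) ^ (|s.re| - ((m : ℝ) + 1) / 2 + ε) := by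
  have hB := jacobiCoeffBound_nonneg m R
  refine ⟨1 + jacobiCoeffBound m R / ε, by positivity, ?_⟩
  have key : ∀ s : ℂ, 0 ≤ s.re → ‖s‖ ≤ R → ∀ x : ℝ, 0 ≤ x → ‖jacobiFun m s x‖ ≤
      (1 + jacobiCoeffBound m R / ε) * (1 + x) ^ (|s.re| - ((m : ℝ) + 1) / 2 + ε) := by
    intro s hs hR x hx
    have h1 : 0 < 1 + x := by linarith
    rw [jacobiFun, norm_mul, norm_one_add_cpow hx, Real.rpow_add h1, abs_of_nonneg hs,
      ← mul_assoc, mul_comm _ ((1 + x) ^ (s.re - _)), mul_assoc]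
    have hre : (s - ((m : ℂ) + 1) / 2).re = s.re - ((m : ℝ) + 1) / 2 := by simp
    rw [hre]
    refine mul_le_mul_of_nonneg_left ?_ (by positivity)
    refine (norm_jacobi_series_le m hs hR hx).trans ?_
    rw [add_mul, one_mul, div_mul_eq_mul_div, mul_div_assoc]
    exact add_le_add (Real.one_le_rpow (by linarith) hε.le)
      (mul_le_mul_of_nonneg_left (Real.log_le_rpow_div h1.le hε) hB)
  intro s hR x hx
  rcases le_total 0 s.re with hs | hs
  · exact key s hs hR x hx
  · have := key (-s) (by simpa using hs) (by simpa using hR) x hx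
    rwa [jacobiFun_neg m s hx, Complex.neg_re, abs_neg] at this

/-- A majorant independent of `s`, with no sign condition on `s.re`: at the real point `-R` every
factor of the rising factorial has the largest possible modulus. It feeds the Weierstrass tests for
continuity and holomorphy in `s`. -/
lemma norm_hypCoeff_jacobi_le (m : ℕ) {R : ℝ} {s : ℂ} (hR : ‖s‖ ≤ R) (n : ℕ) :
    ‖hypCoeff ((m + 1) / 2 - s) ((m + 1) / 2 - s) (m + 1) n‖ ≤
      ‖hypCoeff ((m + 1) / 2 - (-(R : ℂ))) ((m + 1) / 2 - (-(R : ℂ))) (m + 1) n‖ := by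
  rw [norm_hypCoeff_jacobi, norm_hypCoeff_jacobi]
  have hp := ascPochhammer_eval_pos (by positivity : 0 < (m : ℝ) + 1) n
  have hR0 : 0 ≤ R := (norm_nonneg s).trans hR
  gcongr
  have hc : ((m : ℂ) + 1) / 2 - (-(R : ℂ)) = ((((m : ℝ) + 1) / 2 + R : ℝ) : ℂ) := by
    push_cast; ring
  rw [hc]
  induction n with
  | zero => simp
  | succ n ih =>
    rw [ascPochhammer_succ_eval, ascPochhammer_succ_eval, norm_mul, norm_mul]
    refine mul_le_mul (ih (ascPochhammer_eval_pos (by positivity) n)) ?_ (norm_nonneg _)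
      (norm_nonneg _)
    rw [← Complex.ofReal_natCast n, ← Complex.ofReal_add, Complex.norm_real, Real.norm_eq_abs,
      abs_of_nonneg (by positivity),
      show ((m : ℂ) + 1) / 2 - s + ((n : ℝ) : ℂ) = ((((m : ℝ) + 1) / 2 + n : ℝ) : ℂ) - s by
        push_cast; ring]
    refine (norm_sub_le _ _).trans ?_
    rw [Complex.norm_real, Real.norm_eq_abs, abs_of_nonneg (by positivity)]
    linarith

lemma differentiable_ascPochhammer_eval (n : ℕ) :
    Differentiable ℂ fun z : ℂ => (ascPochhammer ℂ n).eval z := Polynomial.differentiable _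

lemma differentiable_hypCoeff_jacobi (m n : ℕ) :
    Differentiable ℂ fun s : ℂ => hypCoeff ((m + 1) / 2 - s) ((m + 1) / 2 - s) (m + 1) n := by
  have h : Differentiable ℂ fun s : ℂ => (ascPochhammer ℂ n).eval (((m : ℂ) + 1) / 2 - s) :=
    (differentiable_ascPochhammer_eval n).comp (by fun_prop)
  exact (((h.const_mul _).mul h).mul_const _)

lemma continuousOn_jacobi_series (m : ℕ) :
    ContinuousOn (fun v : ℂ × ℂ =>
      ₂F₁ ((m + 1) / 2 - v.1) ((m + 1) / 2 - v.1) (m + 1) v.2) {v | ‖v.2‖ < 1} := by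
  intro v hv
  obtain ⟨ρ, h1, h2⟩ := exists_between (show ‖v.2‖ < 1 from hv)
  have hρ : 0 < ρ := (norm_nonneg _).trans_lt h1
  set R := ‖v.1‖ + 1
  set S : Set (ℂ × ℂ) := {w | ‖w.1‖ < R ∧ ‖w.2‖ < ρ}
  have hS : S ∈ 𝓝 v := by
    have h3 : {w : ℂ × ℂ | ‖w.1‖ < R} ∈ 𝓝 v :=
      (isOpen_lt (by fun_prop) (by fun_prop)).mem_nhds (by simp [R])
    have h4 : {w : ℂ × ℂ | ‖w.2‖ < ρ} ∈ 𝓝 v :=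
      (isOpen_lt (by fun_prop) (by fun_prop)).mem_nhds h1
    exact Filter.inter_mem h3 h4
  simp only [ordinaryHypergeometric_eq_tsum_hypCoeff]
  refine ContinuousAt.continuousWithinAt (ContinuousOn.continuousAt ?_ hS)
  refine continuousOn_tsum (fun n => ?_)
    (summable_norm_hypCoeff_mul_pow ((m + 1) / 2 - (-(R : ℂ))) ((m + 1) / 2 - (-(R : ℂ))) (m + 1)
      (y := (ρ : ℂ)) (by rwa [Complex.norm_real, Real.norm_eq_abs, abs_of_pos hρ])) ?_
  · exact (((differentiable_hypCoeff_jacobi m n).continuous.comp continuous_fst).mul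
      (continuous_snd.pow n)).continuousOn
  · intro n w hw
    rw [norm_mul _ (w.2 ^ n), norm_mul _ ((ρ : ℂ) ^ n), norm_pow, norm_pow, Complex.norm_real,
      Real.norm_eq_abs, abs_of_pos hρ]
    exact mul_le_mul (norm_hypCoeff_jacobi_le m hw.1.le n)
      (pow_le_pow_left₀ (norm_nonneg _) hw.2.le n) (by positivity) (norm_nonneg _)

lemma one_add_ofReal_mem_slitPlane {x : ℝ} (hx : 0 ≤ x) : 1 + (x : ℂ) ∈ Complex.slitPlane := by
  rw [← Complex.ofReal_one, ← Complex.ofReal_add]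
  exact Complex.ofReal_mem_slitPlane.mpr (by linarith)

lemma continuous_jacobiFun_abs (m : ℕ) :
    Continuous fun v : ℂ × ℝ => jacobiFun m v.1 |v.2| := by
  unfold jacobiFun
  refine Continuous.mul ?_ ?_
  · refine Continuous.cpow (by fun_prop) (by fun_prop) fun v => ?_
    exact one_add_ofReal_mem_slitPlane (abs_nonneg _)
  · refine (continuousOn_jacobi_series m).comp_continuous
      (f := fun v : ℂ × ℝ => (v.1, ((|v.2| : ℝ) : ℂ) / (1 + (|v.2| : ℝ)))) ?_ fun v => ?_
    · refine continuous_fst.prodMk (Continuous.div (by fun_prop) (by fun_prop) fun v => ?_)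
      exact Complex.slitPlane_ne_zero (one_add_ofReal_mem_slitPlane (abs_nonneg _))
    · simp only [Set.mem_ofPred_eq, norm_ofReal_div_one_add (abs_nonneg v.2)]
      exact div_one_add_lt_one (abs_nonneg _)

lemma differentiable_jacobiFun (m : ℕ) {x : ℝ} (hx : 0 ≤ x) :
    Differentiable ℂ fun s : ℂ => jacobiFun m s x := by
  have hy : ‖(x : ℂ) / (1 + x)‖ < 1 := by
    rw [norm_ofReal_div_one_add hx]; exact div_one_add_lt_one hx
  unfold jacobiFun
  refine Differentiable.mul ?_ ?_
  · refine Differentiable.const_cpow (by fun_prop) (Or.inl ?_)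
    exact Complex.slitPlane_ne_zero (one_add_ofReal_mem_slitPlane hx)
  · simp only [ordinaryHypergeometric_eq_tsum_hypCoeff]
    intro s
    have hs : s ∈ Metric.ball (0 : ℂ) (‖s‖ + 1) := by simp
    refine DifferentiableOn.differentiableAt ?_ (Metric.isOpen_ball.mem_nhds hs)
    refine Complex.differentiableOn_tsum_of_summable_norm
      (summable_norm_hypCoeff_mul_pow ((m + 1) / 2 - (-((‖s‖ + 1 : ℝ) : ℂ)))
        ((m + 1) / 2 - (-((‖s‖ + 1 : ℝ) : ℂ))) (m + 1) hy) (fun n => ?_) Metric.isOpen_ball ?_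
    · exact ((differentiable_hypCoeff_jacobi m n).mul_const _).differentiableOn
    · intro n w hw
      rw [norm_mul _ (((x : ℂ) / (1 + x)) ^ n), norm_mul _ (((x : ℂ) / (1 + x)) ^ n)]
      exact mul_le_mul_of_nonneg_right
        (norm_hypCoeff_jacobi_le m (mem_ball_zero_iff.mp hw).le n) (norm_nonneg _)

/-! ### Gauss's summation theorem -/

lemma norm_ascPochhammer_eval_add_natCast_le {c : ℂ} (hc : 0 < c.re) (N n : ℕ) :
    ‖(ascPochhammer ℂ n).eval c‖ ≤ ‖(ascPochhammer ℂ n).eval (c + N)‖ := by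
  induction n with
  | zero => simp
  | succ n ih =>
    rw [ascPochhammer_succ_eval, ascPochhammer_succ_eval, norm_mul, norm_mul]
    refine mul_le_mul ih ?_ (norm_nonneg _) (norm_nonneg _)
    rw [← sq_le_sq₀ (norm_nonneg _) (norm_nonneg _), ← Complex.normSq_eq_norm_sq,
      ← Complex.normSq_eq_norm_sq, Complex.normSq_apply, Complex.normSq_apply]
    simp
    have hn : (0 : ℝ) ≤ n := n.cast_nonneg
    have hN : (0 : ℝ) ≤ N := N.cast_nonneg
    nlinarith

lemma ascPochhammer_eval_ne_zero_of_re_pos {c : ℂ} (hc : 0 < c.re) (n : ℕ) :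
    (ascPochhammer ℂ n).eval c ≠ 0 := by
  rw [Ne, ascPochhammer_eval_eq_zero_iff]
  rintro ⟨k, -, hk⟩
  have := congrArg Complex.re hk
  simp at this
  have hk0 : (0 : ℝ) ≤ k := k.cast_nonneg
  linarith

lemma add_natCast_ne_zero_of_re_pos {c : ℂ} (hc : 0 < c.re) (n : ℕ) : c + n ≠ 0 := by
  intro h
  have := congrArg Complex.re h
  simp at this
  have hk0 : (0 : ℝ) ≤ n := n.cast_nonneg
  linarith

lemma norm_hypCoeff_add_natCast_le (a b : ℂ) {c : ℂ} (hc : 0 < c.re) (N n : ℕ) :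
    ‖hypCoeff a b (c + N) n‖ ≤ ‖hypCoeff a b c n‖ := by
  rw [hypCoeff, hypCoeff, ordinaryHypergeometricCoefficient, ordinaryHypergeometricCoefficient,
    norm_mul _ (((ascPochhammer ℂ n).eval (c + N))⁻¹), norm_mul _ (((ascPochhammer ℂ n).eval c)⁻¹),
    norm_inv, norm_inv]
  refine mul_le_mul_of_nonneg_left ?_ (norm_nonneg _)
  exact inv_anti₀ (norm_pos_iff.mpr (ascPochhammer_eval_ne_zero_of_re_pos hc n))
    (norm_ascPochhammer_eval_add_natCast_le hc N n)

lemma tendsto_hypCoeff_add_natCast (a b : ℂ) {c : ℂ} (hc : 0 < c.re) (n : ℕ) :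
    Filter.Tendsto (fun N : ℕ => hypCoeff a b (c + N) (n + 1)) Filter.atTop (𝓝 0) := by
  have h : ∀ N : ℕ, ‖hypCoeff a b (c + N) (n + 1)‖ ≤
      ‖hypCoeff a b c (n + 1)‖ * ‖c‖ * ‖(c + N)⁻¹‖ := by
    intro N
    have h1 := norm_hypCoeff_add_natCast_le a b (c := c + 1) (by simp; linarith) N
    have hcN := add_natCast_ne_zero_of_re_pos hc N
    have hc0 : c ≠ 0 := by simpa using add_natCast_ne_zero_of_re_pos hc 0
    have hp : ‖(ascPochhammer ℂ n).eval (c + 1)‖ ≤ ‖(ascPochhammer ℂ n).eval (c + N + 1)‖ := by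
      rw [add_right_comm]
      exact norm_ascPochhammer_eval_add_natCast_le (by simp; linarith) N n
    have hp0 : 0 < ‖(ascPochhammer ℂ n).eval (c + 1)‖ :=
      norm_pos_iff.mpr (ascPochhammer_eval_ne_zero_of_re_pos (by simp; linarith) n)
    rw [hypCoeff, hypCoeff, ordinaryHypergeometricCoefficient, ordinaryHypergeometricCoefficient,
      norm_mul _ (((ascPochhammer ℂ (n + 1)).eval (c + N))⁻¹),
      norm_mul _ (((ascPochhammer ℂ (n + 1)).eval c)⁻¹), norm_inv, norm_inv, norm_inv,
      ascPochhammer_eval_succ_left c, ascPochhammer_eval_succ_left (c + N),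
      norm_mul c ((ascPochhammer ℂ n).eval (c + 1)),
      norm_mul (c + N) ((ascPochhammer ℂ n).eval (c + N + 1)), mul_assoc _ ‖c‖,
      mul_assoc _ _ (‖c‖ * _)]
    refine mul_le_mul_of_nonneg_left ?_ (norm_nonneg _)
    have e : (‖c‖ * ‖(ascPochhammer ℂ n).eval (c + 1)‖)⁻¹ * (‖c‖ * ‖c + N‖⁻¹) =
        ‖c + N‖⁻¹ * ‖(ascPochhammer ℂ n).eval (c + 1)‖⁻¹ := by
      have := norm_ne_zero_iff.mpr hc0
      field_simp
    rw [e, mul_inv]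
    exact mul_le_mul_of_nonneg_left (inv_anti₀ hp0 hp) (by positivity)
  refine squeeze_zero_norm h ?_
  have h2 : Filter.Tendsto (fun N : ℕ => ‖(c + N)⁻¹‖) Filter.atTop (𝓝 0) := by
    refine squeeze_zero' (Filter.Eventually.of_forall fun _ => norm_nonneg _) ?_
      (tendsto_inv_atTop_nhds_zero_nat (𝕜 := ℝ))
    filter_upwards [Filter.eventually_gt_atTop 0] with N hN
    rw [norm_inv]
    refine inv_anti₀ (by exact_mod_cast hN) ?_
    refine le_trans ?_ (Complex.re_le_norm _)
    simp
    exact hc.le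
  simpa using h2.const_mul (‖hypCoeff a b c (n + 1)‖ * ‖c‖)

lemma hypCoeff_succ (a b : ℂ) {c : ℂ} (hc : 0 < c.re) (n : ℕ) :
    hypCoeff a b c (n + 1) * ((n + 1) * (c + n)) = hypCoeff a b c n * ((a + n) * (b + n)) := by
  have h1 := add_natCast_ne_zero_of_re_pos hc n
  have h2 := ascPochhammer_eval_ne_zero_of_re_pos hc n
  have h3 : (n.factorial : ℂ) ≠ 0 := by exact_mod_cast n.factorial_ne_zero
  have h4 : (n : ℂ) + 1 ≠ 0 := by exact_mod_cast n.succ_ne_zero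
  simp only [hypCoeff, ordinaryHypergeometricCoefficient, ascPochhammer_succ_eval,
    Nat.factorial_succ]
  push_cast
  field_simp

lemma hypCoeff_add_one (a b : ℂ) {c : ℂ} (hc : 0 < c.re) (n : ℕ) :
    hypCoeff a b (c + 1) n * (c + n) = hypCoeff a b c n * c := by
  have h1 := ascPochhammer_eval_ne_zero_of_re_pos hc n
  have h2 := ascPochhammer_eval_ne_zero_of_re_pos (c := c + 1) (by simp; linarith) n
  have h : (ascPochhammer ℂ n).eval c * (c + n) = c * (ascPochhammer ℂ n).eval (c + 1) := by
    rw [← ascPochhammer_succ_eval, ascPochhammer_eval_succ_left]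
  simp only [hypCoeff, ordinaryHypergeometricCoefficient]
  field_simp
  linear_combination (n.factorial : ℂ)⁻¹ * (ascPochhammer ℂ n).eval a *
    (ascPochhammer ℂ n).eval b * h

/-- A non-zero limit would make `‖u n‖` at least a constant times `1 / n`, against the divergence of
the harmonic series. -/
lemma eq_zero_of_tendsto_natCast_mul {u : ℕ → ℂ} {L : ℂ} (hu : Summable fun n => ‖u n‖)
    (h : Filter.Tendsto (fun n : ℕ => (n : ℂ) * u n) Filter.atTop (𝓝 L)) : L = 0 := by
  by_contra hL
  have hL' : ‖L‖ / 2 < ‖L‖ := half_lt_self (norm_pos_iff.mpr hL)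
  have h1 := h.norm.eventually_const_lt hL'
  obtain ⟨N, hN⟩ := Filter.eventually_atTop.mp h1
  refine Real.not_summable_one_div_natCast ?_
  rw [← summable_nat_add_iff (N + 1)]
  have hp : 0 < ‖L‖ / 2 := half_pos (norm_pos_iff.mpr hL)
  refine Summable.of_nonneg_of_le (fun n => by positivity) (fun n => ?_)
    (((summable_nat_add_iff (N + 1)).mpr hu).mul_left (‖L‖ / 2)⁻¹)
  have h2 := hN (n + (N + 1)) (by omega)
  rw [norm_mul, Complex.norm_natCast] at h2
  have hn : (0 : ℝ) < ((n + (N + 1) : ℕ) : ℝ) := by exact_mod_cast (by omega)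
  rw [div_le_iff₀ hn, mul_assoc, mul_comm ‖u _‖, inv_mul_eq_div, le_div_iff₀ hp]
  linarith

/-- The difference of the two sides telescopes termwise, with `u n = c n · hypCoeff a b c n`.
Convergence of the series forces `u n` to have a limit, and summability forces that limit to be
zero, so no asymptotics of the coefficients are needed. -/
lemma tsum_hypCoeff_contiguous (a b : ℂ) {c : ℂ} (hc : 0 < c.re)
    (hs : Summable fun n => ‖hypCoeff a b c n‖) :
    c * (c - a - b) * ∑' n, hypCoeff a b c n =
      (c - a) * (c - b) * ∑' n, hypCoeff a b (c + 1) n := by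
  have hs1 : Summable fun n => ‖hypCoeff a b (c + 1) n‖ :=
    Summable.of_nonneg_of_le (fun _ => norm_nonneg _)
      (fun n => by simpa using norm_hypCoeff_add_natCast_le a b hc 1 n) hs
  have hc0 : c ≠ 0 := by simpa using add_natCast_ne_zero_of_re_pos hc 0
  set u : ℕ → ℂ := fun n => c * ((n : ℂ) * hypCoeff a b c n) with hu
  have key : ∀ n, c * (c - a - b) * hypCoeff a b c n - (c - a) * (c - b) * hypCoeff a b (c + 1) n =
      u n - u (n + 1) := by
    intro n
    have h1 := add_natCast_ne_zero_of_re_pos hc n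
    have e1 := hypCoeff_succ a b hc n
    have e2 := hypCoeff_add_one a b hc n
    refine mul_right_cancel₀ h1 ?_
    simp only [hu]
    push_cast
    linear_combination (-(c - a) * (c - b)) * e2 + c * e1
  have hsum : HasSum (fun n => u n - u (n + 1)) (c * (c - a - b) * ∑' n, hypCoeff a b c n -
      (c - a) * (c - b) * ∑' n, hypCoeff a b (c + 1) n) := by
    simp only [← key]
    exact (hs.of_norm.hasSum.mul_left _).sub (hs1.of_norm.hasSum.mul_left _)
  have ht := hsum.tendsto_sum_nat
  simp only [Finset.sum_range_sub'] at ht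
  have hu0 : u 0 = 0 := by simp [hu]
  simp only [hu0, zero_sub] at ht
  have ht2 := ht.neg
  simp only [neg_neg] at ht2
  have ht3 := ht2.const_mul c⁻¹
  simp only [hu, inv_mul_cancel_left₀ hc0] at ht3
  have := eq_zero_of_tendsto_natCast_mul hs ht3
  rw [mul_eq_zero, or_iff_right (inv_ne_zero hc0), neg_eq_zero] at this
  exact sub_eq_zero.mp this

/-- **Gauss's summation theorem**, under an explicit summability hypothesis. -/
lemma tsum_hypCoeff_eq_Gamma {a b c : ℂ} (hc : 0 < c.re) (ha : 0 < (c - a).re)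
    (hb : 0 < (c - b).re) (hab : 0 < (c - a - b).re)
    (hs : Summable fun n => ‖hypCoeff a b c n‖) :
    ∑' n, hypCoeff a b c n = Complex.Gamma c * Complex.Gamma (c - a - b) /
      (Complex.Gamma (c - a) * Complex.Gamma (c - b)) := by
  have hsN : ∀ N : ℕ, Summable fun n => ‖hypCoeff a b (c + N) n‖ := fun N =>
    Summable.of_nonneg_of_le (fun _ => norm_nonneg _)
      (fun n => norm_hypCoeff_add_natCast_le a b hc N n) hs
  have hlim : Filter.Tendsto (fun N : ℕ => ∑' n, hypCoeff a b (c + N) n) Filter.atTop (𝓝 1) := by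
    have h := tendsto_tsum_of_dominated_convergence (𝓕 := Filter.atTop)
      (f := fun (N : ℕ) n => hypCoeff a b (c + N) n) (g := fun n => if n = 0 then (1 : ℂ) else 0)
      hs (fun n => by
        rcases n with _ | n
        · simp [hypCoeff, ordinaryHypergeometricCoefficient]
        · simpa using tendsto_hypCoeff_add_natCast a b hc n)
      (Filter.Eventually.of_forall fun N n => norm_hypCoeff_add_natCast_le a b hc N n)
    simpa using h
  -- The contiguous relation is iterated `N` times; the series at `c + N` tends to its constant term
  -- `1`.
  have hprod : ∀ N : ℕ, ∑' n, hypCoeff a b c n =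
      (∏ j ∈ Finset.range N, ((c - a + j) * (c - b + j) / ((c + j) * (c - a - b + j)))) *
        ∑' n, hypCoeff a b (c + N) n := by
    intro N
    induction N with
    | zero => simp
    | succ N ih =>
      have h := tsum_hypCoeff_contiguous a b (c := c + N)
        (by simp; linarith [(N.cast_nonneg : (0 : ℝ) ≤ N)]) (hsN N)
      have h1 := add_natCast_ne_zero_of_re_pos hc N
      have h2 := add_natCast_ne_zero_of_re_pos hab N
      rw [ih, Finset.prod_range_succ, mul_assoc]
      congr 1
      rw [div_mul_eq_mul_div, eq_div_iff (mul_ne_zero h1 h2)]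
      push_cast
      rw [← add_assoc]
      linear_combination h
  have hG : Filter.Tendsto (fun n => Complex.GammaSeq c n * Complex.GammaSeq (c - a - b) n /
      (Complex.GammaSeq (c - a) n * Complex.GammaSeq (c - b) n)) Filter.atTop
      (𝓝 (Complex.Gamma c * Complex.Gamma (c - a - b) /
      (Complex.Gamma (c - a) * Complex.Gamma (c - b)))) :=
    ((Complex.GammaSeq_tendsto_Gamma c).mul (Complex.GammaSeq_tendsto_Gamma _)).div
      ((Complex.GammaSeq_tendsto_Gamma _).mul (Complex.GammaSeq_tendsto_Gamma _))
      (mul_ne_zero (Complex.Gamma_ne_zero_of_re_pos ha) (Complex.Gamma_ne_zero_of_re_pos hb))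
  -- The product is the quotient of Euler's sequences: the factorials cancel, and so do the powers
  -- of `n`, since `c + (c - a - b) = (c - a) + (c - b)`.
  have hP : Filter.Tendsto (fun n : ℕ => ∏ j ∈ Finset.range (n + 1),
      ((c - a + j) * (c - b + j) / ((c + j) * (c - a - b + j)))) Filter.atTop
      (𝓝 (Complex.Gamma c * Complex.Gamma (c - a - b) /
      (Complex.Gamma (c - a) * Complex.Gamma (c - b)))) := by
    refine hG.congr' ?_
    filter_upwards [Filter.eventually_gt_atTop 0] with n hn
    have hn0 : (n : ℂ) ≠ 0 := by exact_mod_cast hn.ne'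
    have hf : (n.factorial : ℂ) ≠ 0 := by exact_mod_cast n.factorial_ne_zero
    have hne : ∀ {z : ℂ}, 0 < z.re → ∏ j ∈ Finset.range (n + 1), (z + j) ≠ 0 := fun hz =>
      Finset.prod_ne_zero_iff.mpr fun j _ => add_natCast_ne_zero_of_re_pos hz j
    have h1 := hne hc
    have h2 := hne ha
    have h3 := hne hb
    have h4 := hne hab
    have hpow : (n : ℂ) ^ c * (n : ℂ) ^ (c - a - b) = (n : ℂ) ^ (c - a) * (n : ℂ) ^ (c - b) := by
      rw [← Complex.cpow_add _ _ hn0, ← Complex.cpow_add _ _ hn0]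
      congr 1
      ring
    have h5 : (n : ℂ) ^ (c - a) ≠ 0 := by simp [Complex.cpow_eq_zero_iff, hn0]
    have h6 : (n : ℂ) ^ (c - b) ≠ 0 := by simp [Complex.cpow_eq_zero_iff, hn0]
    simp only [Complex.GammaSeq, Finset.prod_div_distrib, Finset.prod_mul_distrib]
    field_simp
    linear_combination hpow
  have h := hP.mul (hlim.comp (Filter.tendsto_add_atTop_nat 1))
  rw [mul_one] at h
  refine tendsto_nhds_unique (tendsto_const_nhds.congr fun n => ?_) h
  exact hprod (n + 1)

/-! ### The Beta integral and the rank-one transform -/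

lemma integrableOn_Ioi_of_norm_le_one_add_rpow {E : Type*} [NormedAddCommGroup E] {f : ℝ → E}
    {C a : ℝ} (hf : ContinuousOn f (Set.Ioi 0)) (ha : a < -1)
    (h : ∀ x, 0 < x → ‖f x‖ ≤ C * (1 + x) ^ a) : IntegrableOn f (Set.Ioi 0) := by
  have h1 : IntegrableOn (fun x : ℝ => C * (1 + x) ^ a) (Set.Ioi 0) := by
    have := (integrableOn_add_rpow_Ioi_of_lt (m := 1) (c := 0) ha (by norm_num)).const_mul C
    simp only [add_comm _ (1 : ℝ)] at this
    exact this
  refine Integrable.mono' h1 (hf.aestronglyMeasurable measurableSet_Ioi) ?_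
  filter_upwards [ae_restrict_mem measurableSet_Ioi] with x hx using h x hx

lemma continuousOn_one_add_cpow (z : ℂ) : ContinuousOn (fun x : ℝ => (1 + (x : ℂ)) ^ z)
    (Set.Ici 0) := by
  refine ContinuousOn.cpow (by fun_prop) (by fun_prop) fun x hx => ?_
  exact one_add_ofReal_mem_slitPlane hx

lemma norm_pow_mul_one_add_cpow_le (k : ℕ) (τ : ℂ) {x : ℝ} (hx : 0 ≤ x) :
    ‖(x : ℂ) ^ k * (1 + (x : ℂ)) ^ (-τ)‖ ≤ (1 + x) ^ (k - τ.re) := by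
  have h1 : 0 < 1 + x := by linarith
  rw [norm_mul, norm_pow, norm_one_add_cpow hx, Complex.norm_real, Real.norm_eq_abs,
    abs_of_nonneg hx, sub_eq_add_neg, Real.rpow_add h1, Real.rpow_natCast, Complex.neg_re]
  gcongr
  linarith

lemma integrableOn_pow_mul_one_add_cpow {k : ℕ} {τ : ℂ} (hτ : (k : ℝ) + 1 < τ.re) :
    IntegrableOn (fun x : ℝ => (x : ℂ) ^ k * (1 + (x : ℂ)) ^ (-τ)) (Set.Ioi 0) :=
  integrableOn_Ioi_of_norm_le_one_add_rpow (C := 1) (a := k - τ.re)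
    (ContinuousOn.mul (by fun_prop) ((continuousOn_one_add_cpow _).mono Set.Ioi_subset_Ici_self))
    (by linarith) fun x hx => by
      rw [one_mul]; exact norm_pow_mul_one_add_cpow_le k τ hx.le

/-- The Beta integral over the half-line, for an integral first argument. -/
lemma integral_pow_mul_one_add_cpow {k : ℕ} {τ : ℂ} (hτ : (k : ℝ) + 1 < τ.re) :
    ∫ x in Set.Ioi (0 : ℝ), (x : ℂ) ^ k * (1 + (x : ℂ)) ^ (-τ) =
      k.factorial * Complex.Gamma (τ - k - 1) / Complex.Gamma τ := by
  induction k generalizing τ with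
  | zero =>
    have h1 : 1 < τ.re := by simpa using hτ
    have hne : τ - 1 ≠ 0 := by
      intro h
      have := congrArg Complex.re h
      simp at this
      linarith
    have hG : Complex.Gamma τ = (τ - 1) * Complex.Gamma (τ - 1) := by
      rw [← Complex.Gamma_add_one _ hne, sub_add_cancel]
    have hd : ∀ x ∈ Set.Ici (0 : ℝ), HasDerivAt
        (fun x : ℝ => (1 + (x : ℂ)) ^ (1 - τ) / (1 - τ)) ((x : ℂ) ^ 0 * (1 + (x : ℂ)) ^ (-τ)) x := by
      intro x hx
      have h2 : HasDerivAt (fun z : ℂ => 1 + z) 1 (x : ℂ) := (hasDerivAt_id _).const_add 1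
      have h3 := ((h2.cpow_const (c := 1 - τ)
        (one_add_ofReal_mem_slitPlane hx)).div_const (1 - τ)).comp_ofReal
      have hne' : 1 - τ ≠ 0 := by rw [← neg_sub]; exact neg_ne_zero.mpr hne
      convert h3 using 1
      rw [show 1 - τ - 1 = -τ by ring]
      field_simp
    have hl : Filter.Tendsto (fun x : ℝ => (1 + (x : ℂ)) ^ (1 - τ) / (1 - τ)) Filter.atTop
        (𝓝 0) := by
      have h4 : Filter.Tendsto (fun x : ℝ => (1 + x) ^ (-(τ.re - 1))) Filter.atTop (𝓝 0) :=
        (tendsto_rpow_neg_atTop (by linarith)).comp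
          (Filter.tendsto_atTop_add_const_left _ 1 Filter.tendsto_id)
      have h5 : Filter.Tendsto (fun x : ℝ => (1 + (x : ℂ)) ^ (1 - τ)) Filter.atTop (𝓝 0) := by
        rw [tendsto_zero_iff_norm_tendsto_zero]
        refine h4.congr' ?_
        filter_upwards [Filter.eventually_ge_atTop 0] with x hx
        rw [norm_one_add_cpow hx]
        simp
      simpa using h5.div_const (1 - τ)
    rw [integral_Ioi_of_hasDerivAt_of_tendsto' hd (integrableOn_pow_mul_one_add_cpow hτ) hl, hG]
    have hG0 : Complex.Gamma (τ - 1) ≠ 0 := Complex.Gamma_ne_zero_of_re_pos (by simp; linarith)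
    have hne' : 1 - τ ≠ 0 := by rw [← neg_sub]; exact neg_ne_zero.mpr hne
    simp
    field_simp
    ring
  | succ k ih =>
    push_cast at hτ
    have hk : (0 : ℝ) ≤ k := k.cast_nonneg
    have hi1 := integrableOn_pow_mul_one_add_cpow (k := k) (τ := τ - 1) (by simp; linarith)
    have hi2 := integrableOn_pow_mul_one_add_cpow (k := k) (τ := τ) (by linarith)
    -- Writing one factor `x` as `(1 + x) - 1` lowers the power of `x`.
    have e : ∫ x in Set.Ioi (0 : ℝ), (x : ℂ) ^ (k + 1) * (1 + (x : ℂ)) ^ (-τ) =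
        ∫ x in Set.Ioi (0 : ℝ), ((x : ℂ) ^ k * (1 + (x : ℂ)) ^ (-(τ - 1)) -
          (x : ℂ) ^ k * (1 + (x : ℂ)) ^ (-τ)) := by
      refine setIntegral_congr_fun measurableSet_Ioi fun x hx => ?_
      have hne : 1 + (x : ℂ) ≠ 0 :=
        Complex.slitPlane_ne_zero (one_add_ofReal_mem_slitPlane (Set.mem_Ioi.mp hx).le)
      rw [show -(τ - 1) = -τ + 1 by ring, Complex.cpow_add _ _ hne, Complex.cpow_one]
      ring
    have h1 : τ - k - 1 - 1 ≠ 0 := by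
      intro h
      have := congrArg Complex.re h
      simp at this
      linarith
    have h2 : τ - 1 ≠ 0 := by
      intro h
      have := congrArg Complex.re h
      simp at this
      linarith
    have hG1 : Complex.Gamma τ = (τ - 1) * Complex.Gamma (τ - 1) := by
      rw [← Complex.Gamma_add_one _ h2, sub_add_cancel]
    have hG2 : Complex.Gamma (τ - k - 1) = (τ - k - 1 - 1) * Complex.Gamma (τ - k - 1 - 1) := by
      rw [← Complex.Gamma_add_one _ h1, sub_add_cancel]
    have hG0 : Complex.Gamma (τ - 1) ≠ 0 := Complex.Gamma_ne_zero_of_re_pos (by simp; linarith)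
    rw [e, integral_sub hi1 hi2, ih (τ := τ - 1) (by simp; linarith), ih (τ := τ) (by linarith),
      hG1, hG2, show τ - 1 - k - 1 = τ - k - 1 - 1 by ring, Nat.factorial_succ,
      show τ - ((k + 1 : ℕ) : ℂ) - 1 = τ - k - 1 - 1 by push_cast; ring]
    push_cast
    field_simp
    ring

lemma rpow_mul_one_add_log_le {m : ℕ} {a C ε : ℝ} (hC : 0 ≤ C) (hε : 0 < ε) {x : ℝ} (hx : 0 ≤ x) :
    x ^ m * (1 + x) ^ a * (1 + C * Real.log (1 + x)) ≤ (1 + C / ε) * (1 + x) ^ (m + a + ε) := by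
  have h1 : 0 < 1 + x := by linarith
  have h2 : 1 + C * Real.log (1 + x) ≤ (1 + C / ε) * (1 + x) ^ ε := by
    rw [add_mul, one_mul, div_mul_eq_mul_div, mul_div_assoc]
    exact add_le_add (Real.one_le_rpow (by linarith) hε.le)
      (mul_le_mul_of_nonneg_left (Real.log_le_rpow_div h1.le hε) hC)
  have h3 : x ^ m ≤ (1 + x) ^ (m : ℝ) := by
    rw [Real.rpow_natCast]
    exact pow_le_pow_left₀ hx (by linarith) m
  have h4 : 0 ≤ 1 + C * Real.log (1 + x) := by
    have := Real.log_nonneg (by linarith : 1 ≤ 1 + x)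
    positivity
  rw [Real.rpow_add h1, Real.rpow_add h1]
  calc x ^ m * (1 + x) ^ a * (1 + C * Real.log (1 + x))
      ≤ (1 + x) ^ (m : ℝ) * (1 + x) ^ a * ((1 + C / ε) * (1 + x) ^ ε) := by gcongr
    _ = _ := by ring

lemma Gamma_add_natCast {z : ℂ} (hz : 0 < z.re) (n : ℕ) :
    Complex.Gamma (z + n) = Complex.Gamma z * (ascPochhammer ℂ n).eval z := by
  rw [← Complex.Gamma_add_nat_div_Gamma_eq (n := n) z, mul_div_cancel₀ _
    (Complex.Gamma_ne_zero_of_re_pos hz)]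
  intro k hk
  have := add_natCast_ne_zero_of_re_pos hz k
  rw [hk] at this
  simp at this

/-- With `τ = σ + r - s`, the `n`-th term of the Pfaff series is a Beta integral whose factor `Γ(σ -
r - s)` does not depend on `n`, and `(m + n)!` cancels the rising factorial of `m + 1`. This leaves
`₂F₁(r - s, r - s; τ; 1)`, to which Gauss's theorem applies. -/
lemma integral_pow_mul_cpow_mul_jacobiFun_of_re_nonneg (m : ℕ) {σ s : ℂ} (hs : 0 ≤ s.re)
    (h : s.re < σ.re - ((m : ℝ) + 1) / 2) :
    ∫ x in Set.Ioi (0 : ℝ), (x : ℂ) ^ m * (1 + (x : ℂ)) ^ (-σ) * jacobiFun m s x =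
      m.factorial * Complex.Gamma (σ - (m + 1) / 2 + s) * Complex.Gamma (σ - (m + 1) / 2 - s) /
        Complex.Gamma σ ^ 2 := by
  set r : ℂ := ((m : ℂ) + 1) / 2 with hr
  have hrre : r.re = ((m : ℝ) + 1) / 2 := by simp [hr]
  have hm0 : (0 : ℝ) ≤ m := m.cast_nonneg
  set C := jacobiCoeffBound m ‖s‖
  have hC : 0 ≤ C := jacobiCoeffBound_nonneg m _
  set τ : ℂ := σ + r - s with hτ
  have hτre : (m : ℝ) + 1 < τ.re := by simp [hτ, hrre]; linarith
  have hτpos : 0 < τ.re := by linarith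
  set w : ℝ → ℝ := fun x => x ^ m * (1 + x) ^ (-τ.re) with hw
  set f : ℕ → ℝ → ℂ := fun n x => hypCoeff (r - s) (r - s) (m + 1) n *
    ((x : ℂ) ^ (m + n) * (1 + (x : ℂ)) ^ (-(τ + n))) with hf
  have hfx : ∀ n, ∀ x ∈ Set.Ioi (0 : ℝ), f n x = (x : ℂ) ^ m * (1 + (x : ℂ)) ^ (-σ) *
      (1 + (x : ℂ)) ^ (s - r) * (hypCoeff (r - s) (r - s) (m + 1) n *
        ((x : ℂ) / (1 + x)) ^ n) := by
    intro n x hx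
    have hne : 1 + (x : ℂ) ≠ 0 :=
      Complex.slitPlane_ne_zero (one_add_ofReal_mem_slitPlane (Set.mem_Ioi.mp hx).le)
    simp only [hf]
    rw [show -(τ + n) = -σ + (s - r) + -(n : ℂ) by rw [hτ]; ring, Complex.cpow_add _ _ hne,
      Complex.cpow_add _ _ hne, Complex.cpow_neg _ (n : ℂ), Complex.cpow_natCast, div_pow, pow_add]
    ring
  -- The term `n = 0` has coefficient one and is kept apart from the `C / n` bound.
  set bound : ℕ → ℝ → ℝ := fun n x => w x * (if n = 0 then 1 else
    C * ((x / (1 + x)) ^ n / n)) with hbound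
  have hbsum : ∀ x ∈ Set.Ioi (0 : ℝ),
      HasSum (fun n => bound n x) (w x * (1 + C * Real.log (1 + x))) := by
    intro x hx
    refine HasSum.mul_left _ ?_
    rw [← hasSum_nat_add_iff' 1]
    simpa using (hasSum_pow_div_log_one_add (Set.mem_Ioi.mp hx).le).mul_left C
  have hint : ∀ n, ∫ x in Set.Ioi (0 : ℝ), f n x = m.factorial * Complex.Gamma (σ - r - s) /
      Complex.Gamma τ * hypCoeff (r - s) (r - s) τ n := by
    intro n
    have hn0 : (0 : ℝ) ≤ n := n.cast_nonneg
    simp only [hf]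
    rw [integral_const_mul, integral_pow_mul_one_add_cpow (by push_cast; simp; linarith),
      Gamma_add_natCast hτpos,
      show τ + n - ((m + n : ℕ) : ℂ) - 1 = σ - r - s by rw [hτ, hr]; push_cast; ring,
      ← factorial_mul_ascPochhammer ℂ m n]
    have h1 := ascPochhammer_eval_natCast_add_one_ne_zero m n
    have h2 := ascPochhammer_eval_ne_zero_of_re_pos hτpos n
    have h3 := Complex.Gamma_ne_zero_of_re_pos hτpos
    simp only [hypCoeff, ordinaryHypergeometricCoefficient]
    field_simp
  have hmeas : ∀ n, AEStronglyMeasurable (f n) (volume.restrict (Set.Ioi 0)) := fun n =>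
    ContinuousOn.aestronglyMeasurable (ContinuousOn.mul continuousOn_const (ContinuousOn.mul
      (by fun_prop) ((continuousOn_one_add_cpow _).mono Set.Ioi_subset_Ici_self)))
      measurableSet_Ioi
  have hbd : ∀ n, ∀ x ∈ Set.Ioi (0 : ℝ), ‖f n x‖ ≤ bound n x := by
    intro n x hx
    have hx0 : 0 ≤ x := (Set.mem_Ioi.mp hx).le
    have h1 : 0 < 1 + x := by linarith
    rw [hfx n x hx, norm_mul, norm_mul, norm_mul, norm_pow, norm_one_add_cpow hx0,
      norm_one_add_cpow hx0, Complex.norm_real, Real.norm_eq_abs, abs_of_nonneg hx0, mul_assoc (x ^ m),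
      ← Real.rpow_add h1,
      show (-σ).re + (s - r).re = -τ.re by simp [hτ]; ring]
    refine mul_le_mul_of_nonneg_left ?_ (by positivity)
    rw [norm_mul _ (((x : ℂ) / (1 + x)) ^ n), norm_pow, norm_ofReal_div_one_add hx0]
    rcases n with _ | n
    · simp [hypCoeff, ordinaryHypergeometricCoefficient]
    · rw [if_neg n.succ_ne_zero]
      push_cast
      rw [mul_div_assoc', ← div_mul_eq_mul_div]
      exact mul_le_mul_of_nonneg_right (norm_hypCoeff_jacobi_succ_le m hs le_rfl n) (by positivity)
  have hbint : Integrable (fun x => ∑' n, bound n x) (volume.restrict (Set.Ioi 0)) := by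
    obtain ⟨ε, hε, hε2⟩ : ∃ ε : ℝ, 0 < ε ∧ (m : ℝ) + -τ.re + ε < -1 :=
      ⟨(τ.re - m - 1) / 2, by linarith, by linarith⟩
    have h1 : IntegrableOn (fun x => w x * (1 + C * Real.log (1 + x))) (Set.Ioi 0) := by
      refine integrableOn_Ioi_of_norm_le_one_add_rpow (C := 1 + C / ε) ?_ hε2 fun x hx => ?_
      · intro x hx
        have hx0 : (0 : ℝ) < 1 + x := by linarith [Set.mem_Ioi.mp hx]
        refine ContinuousAt.continuousWithinAt ?_
        refine ContinuousAt.mul (ContinuousAt.mul (by fun_prop)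
          (ContinuousAt.rpow_const (by fun_prop) (Or.inl hx0.ne'))) ?_
        exact continuousAt_const.add (continuousAt_const.mul
          (ContinuousAt.log (by fun_prop) hx0.ne'))
      · rw [Real.norm_eq_abs, abs_of_nonneg]
        · exact rpow_mul_one_add_log_le hC hε hx.le
        · have := Real.log_nonneg (by linarith : 1 ≤ 1 + x)
          have : 0 < 1 + x := by linarith
          simp only [hw]
          positivity
    refine h1.congr_fun (fun x hx => (hbsum x hx).tsum_eq.symm) measurableSet_Ioi
  have hlim : ∀ x ∈ Set.Ioi (0 : ℝ), HasSum (fun n => f n x)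
      ((x : ℂ) ^ m * (1 + (x : ℂ)) ^ (-σ) * jacobiFun m s x) := by
    intro x hx
    have hx0 : 0 ≤ x := (Set.mem_Ioi.mp hx).le
    simp only [hfx _ x hx]
    rw [jacobiFun, ← mul_assoc]
    refine (hasSum_hypCoeff_mul_pow _ _ _ ?_).mul_left _
    rw [norm_ofReal_div_one_add hx0]
    exact div_one_add_lt_one hx0
  have hmem := ae_restrict_mem (μ := volume) (measurableSet_Ioi (a := (0 : ℝ)))
  have key := hasSum_integral_of_dominated_convergence bound hmeas
    (fun n => hmem.mono fun x hx => hbd n x hx)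
    (hmem.mono fun x hx => (hbsum x hx).summable) hbint (hmem.mono fun x hx => hlim x hx)
  simp only [hint] at key
  have hG1 : 0 < (σ - r - s).re := by simp [hrre]; linarith
  have hcst : m.factorial * Complex.Gamma (σ - r - s) / Complex.Gamma τ ≠ 0 :=
    div_ne_zero (mul_ne_zero (by exact_mod_cast m.factorial_ne_zero)
      (Complex.Gamma_ne_zero_of_re_pos hG1)) (Complex.Gamma_ne_zero_of_re_pos hτpos)
  -- Termwise integration already yields a summable complex series, hence an absolutely summable
  -- one, as Gauss's theorem requires.
  have hsum : Summable fun n => ‖hypCoeff (r - s) (r - s) τ n‖ :=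
    ((summable_mul_left_iff hcst).mp key.summable).norm
  have hca : τ - (r - s) = σ := by rw [hτ]; ring
  have hσ : 0 < σ.re := by linarith
  have hG := tsum_hypCoeff_eq_Gamma hτpos (by rwa [hca]) (by rwa [hca])
    (by rw [hca]; simp [hrre]; linarith) hsum
  rw [← key.tsum_eq, tsum_mul_left, hG, hca, show σ - (r - s) = σ - r + s by ring]
  have := Complex.Gamma_ne_zero_of_re_pos hτpos
  have := Complex.Gamma_ne_zero_of_re_pos hσ
  field_simp

/-- The spherical transform in rank one of a power of `1 + x`. -/
lemma integral_pow_mul_cpow_mul_jacobiFun (m : ℕ) {σ s : ℂ}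
    (h : |s.re| < σ.re - ((m : ℝ) + 1) / 2) :
    ∫ x in Set.Ioi (0 : ℝ), (x : ℂ) ^ m * (1 + (x : ℂ)) ^ (-σ) * jacobiFun m s x =
      m.factorial * Complex.Gamma (σ - (m + 1) / 2 + s) * Complex.Gamma (σ - (m + 1) / 2 - s) /
        Complex.Gamma σ ^ 2 := by
  rcases le_total 0 s.re with hs | hs
  · exact integral_pow_mul_cpow_mul_jacobiFun_of_re_nonneg m hs (by rwa [abs_of_nonneg hs] at h)
  · have h1 := integral_pow_mul_cpow_mul_jacobiFun_of_re_nonneg m (σ := σ) (s := -s)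
      (by simpa using hs) (by rwa [abs_of_nonpos hs] at h)
    rw [sub_neg_eq_add, ← sub_eq_add_neg] at h1
    rw [mul_right_comm, ← h1]
    refine setIntegral_congr_fun measurableSet_Ioi fun x hx => ?_
    rw [jacobiFun_neg m s (Set.mem_Ioi.mp hx).le]

/-! ### Divided differences depending on parameters -/

/-- Away from the diagonal this is continuity of a quotient. At the diagonal, a small circle around
the node stays off the diagonal; closeness there is uniform by compactness, and the maximum
principle carries it inside. -/
lemma continuous_dslope_of_continuous {P : Type*} [TopologicalSpace P] {U : Set ℂ}
    (hU : IsOpen U) {g : P → ℂ → ℂ} {a : P → U} (ha : Continuous a)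
    (hd : ∀ p, DifferentiableOn ℂ (g p) U) (hc : Continuous fun y : P × U => g y.1 y.2) :
    Continuous fun y : P × U => dslope (g y.1) (a y.1) y.2 := by
  have hdd : ∀ p, DifferentiableOn ℂ (dslope (g p) (a p)) U := fun p =>
    (Complex.differentiableOn_dslope (hU.mem_nhds (a p).2)).mpr (hd p)
  have hoff : ∀ p (b : U), b ≠ a p →
      ContinuousAt (fun y : P × U => dslope (g y.1) (a y.1) y.2) (p, b) := by
    intro p b hb
    have hne : ∀ᶠ y : P × U in 𝓝 (p, b), y.2 ≠ a y.1 :=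
      (isOpen_ne_fun continuous_snd (ha.comp continuous_fst)).mem_nhds hb
    have hne' : (b : ℂ) - a p ≠ 0 := fun h => hb (Subtype.ext (sub_eq_zero.mp h))
    have hA : ContinuousAt (fun y : P × U => (y.2 : ℂ) - a y.1) (p, b) :=
      ((continuous_subtype_val.comp continuous_snd).sub
          (continuous_subtype_val.comp (ha.comp continuous_fst))).continuousAt
    have hB : ContinuousAt (fun y : P × U => g y.1 y.2 - g y.1 (a y.1)) (p, b) :=
      (hc.sub (hc.comp (continuous_fst.prodMk (ha.comp continuous_fst)))).continuousAt
    have h1 := (hA.inv₀ hne').smul hB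
    refine h1.congr ?_
    filter_upwards [hne] with y hy
    rw [dslope_of_ne _ (fun h => hy (Subtype.ext h)), slope_def_module]
    rfl
  rw [continuous_iff_continuousAt]
  rintro ⟨p₀, b₀⟩
  by_cases hb : b₀ = a p₀
  swap
  · exact hoff p₀ b₀ hb
  obtain ⟨δ, hδ, hball⟩ := Metric.nhds_basis_closedBall.mem_iff.mp (hU.mem_nhds b₀.2)
  have hsph : ∀ w ∈ Metric.sphere (b₀ : ℂ) δ, w ∈ U := fun w hw =>
    hball (Metric.sphere_subset_closedBall hw)
  rw [Metric.continuousAt_iff']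
  intro ε hε
  have hS : IsCompact ((↑) ⁻¹' Metric.sphere (b₀ : ℂ) δ : Set U) :=
    Topology.IsInducing.subtypeVal.isCompact_preimage' (isCompact_sphere _ _)
      (by rw [Subtype.range_coe]; exact hsph)
  have hunif : ∀ᶠ p in 𝓝 p₀, ∀ w ∈ ((↑) ⁻¹' Metric.sphere (b₀ : ℂ) δ : Set U),
      ‖dslope (g p) (a p) w - dslope (g p₀) (a p₀) w‖ < ε / 2 := by
    refine hS.eventually_forall_of_forall_eventually fun w hw => ?_
    have hwne : w ≠ a p₀ := by
      rintro rfl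
      rw [← hb, Set.mem_preimage, Metric.mem_sphere, dist_self] at hw
      exact hδ.ne hw
    have h1 := hoff p₀ w hwne
    have h2 : ContinuousAt (fun y : P × U => dslope (g p₀) (a p₀) y.2) (p₀, w) :=
      h1.comp (f := fun y : P × U => (p₀, y.2)) (x := (p₀, w)) (by fun_prop)
    have h3 := (h1.tendsto.sub h2.tendsto).norm
    simp only [sub_self, norm_zero] at h3
    exact h3.eventually_lt_const (half_pos hε)
  have hfix : ∀ᶠ b : U in 𝓝 b₀, ‖dslope (g p₀) (a p₀) b - dslope (g p₀) (a p₀) b₀‖ < ε / 2 := by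
    have h1 : ContinuousAt (fun b : U => dslope (g p₀) (a p₀) b) b₀ :=
      (((hdd p₀).continuousOn.continuousAt (hU.mem_nhds b₀.2))).comp
        continuous_subtype_val.continuousAt
    have h3 := (h1.tendsto.sub (tendsto_const_nhds (x := dslope (g p₀) (a p₀) b₀))).norm
    simp only [sub_self, norm_zero] at h3
    exact h3.eventually_lt_const (half_pos hε)
  have hnear : ∀ᶠ b : U in 𝓝 b₀, (b : ℂ) ∈ Metric.closedBall (b₀ : ℂ) δ :=
    continuous_subtype_val.continuousAt.eventually (Metric.closedBall_mem_nhds _ hδ)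
  rw [nhds_prod_eq]
  filter_upwards [hunif.prod_mk (hfix.and hnear)] with y hy
  obtain ⟨hy1, hy2, hy3⟩ := hy
  have hmax : ‖dslope (g y.1) (a y.1) y.2 - dslope (g p₀) (a p₀) y.2‖ ≤ ε / 2 := by
    have hdiff : DiffContOnCl ℂ (fun b => dslope (g y.1) (a y.1) b - dslope (g p₀) (a p₀) b)
        (Metric.ball (b₀ : ℂ) δ) := by
      refine DifferentiableOn.diffContOnCl ?_
      rw [closure_ball _ hδ.ne']
      exact ((hdd _).mono hball).sub ((hdd _).mono hball)
    refine Complex.norm_le_of_forall_mem_frontier_norm_le Metric.isBounded_ball hdiff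
      (fun w hw => ?_) (by rwa [closure_ball _ hδ.ne'])
    rw [frontier_ball _ hδ.ne'] at hw
    exact (hy1 ⟨w, hsph w hw⟩ hw).le
  rw [dist_eq_norm]
  calc _ = ‖(dslope (g y.1) (a y.1) y.2 - dslope (g p₀) (a p₀) y.2) +
        (dslope (g p₀) (a p₀) y.2 - dslope (g p₀) (a p₀) b₀)‖ := by rw [sub_add_sub_cancel]
    _ ≤ _ := norm_add_le _ _
    _ < ε := by linarith

/-- The same maximum-principle argument, uniform in an index `x` that ranges over a set without
topology. It later supplies the dominating function on the whole half-line. -/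
lemma eventually_bounded_dslope {P X : Type*} [TopologicalSpace P] {U : Set ℂ}
    (hU : IsOpen U) {g : P → X → ℂ → ℂ} {a : P → U} (ha : Continuous a)
    (hd : ∀ p x, DifferentiableOn ℂ (g p x) U)
    (hb : ∀ (p : P) (b : U), ∃ C, ∀ᶠ y : P × U in 𝓝 (p, b), ∀ x, ‖g y.1 x y.2‖ ≤ C)
    (p₀ : P) (b₀ : U) :
    ∃ C, ∀ᶠ y : P × U in 𝓝 (p₀, b₀), ∀ x, ‖dslope (g y.1 x) (a y.1) y.2‖ ≤ C := by
  have hdd : ∀ p x, DifferentiableOn ℂ (dslope (g p x) (a p)) U := fun p x =>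
    (Complex.differentiableOn_dslope (hU.mem_nhds (a p).2)).mpr (hd p x)
  have hoff : ∀ p (b : U), b ≠ a p →
      ∃ C, ∀ᶠ y : P × U in 𝓝 (p, b), ∀ x, ‖dslope (g y.1 x) (a y.1) y.2‖ ≤ C := by
    intro p b hpb
    have hne : ∀ᶠ y : P × U in 𝓝 (p, b), y.2 ≠ a y.1 :=
      (isOpen_ne_fun continuous_snd (ha.comp continuous_fst)).mem_nhds hpb
    have hne' : 0 < ‖(b : ℂ) - a p‖ := norm_pos_iff.mpr
      fun h => hpb (Subtype.ext (sub_eq_zero.mp h))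
    obtain ⟨C₁, h1⟩ := hb p b
    obtain ⟨C₂, h2⟩ := hb p (a p)
    have h2' : ∀ᶠ y : P × U in 𝓝 (p, b), ∀ x, ‖g y.1 x (a y.1)‖ ≤ C₂ :=
      ((continuous_fst.prodMk (ha.comp continuous_fst)).tendsto ((p, b) : P × U)).eventually h2
    have h3 : ContinuousAt (fun y : P × U => ‖(y.2 : ℂ) - a y.1‖) (p, b) :=
      ((continuous_subtype_val.comp continuous_snd).sub
          (continuous_subtype_val.comp (ha.comp continuous_fst))).norm.continuousAt
    have h4 := h3.eventually_const_lt (half_lt_self hne')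
    refine ⟨(‖(b : ℂ) - a p‖ / 2)⁻¹ * (C₁ + C₂), ?_⟩
    filter_upwards [hne, h1, h2', h4] with y hy hy1 hy2 hy4 x
    rw [dslope_of_ne _ (fun h => hy (Subtype.ext h)), slope_def_module, norm_smul, norm_inv]
    refine mul_le_mul (inv_anti₀ (half_pos hne') hy4.le)
      ((norm_sub_le _ _).trans (add_le_add (hy1 x) (hy2 x))) (norm_nonneg _) (by positivity)
  by_cases hb : b₀ = a p₀
  swap
  · exact hoff p₀ b₀ hb
  obtain ⟨δ, hδ, hball⟩ := Metric.nhds_basis_closedBall.mem_iff.mp (hU.mem_nhds b₀.2)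
  have hsph : ∀ w ∈ Metric.sphere (b₀ : ℂ) δ, w ∈ U := fun w hw =>
    hball (Metric.sphere_subset_closedBall hw)
  have hS : IsCompact ((↑) ⁻¹' Metric.sphere (b₀ : ℂ) δ : Set U) :=
    Topology.IsInducing.subtypeVal.isCompact_preimage' (isCompact_sphere _ _)
      (by rw [Subtype.range_coe]; exact hsph)
  have hunif : ∃ C, ∀ᶠ p in 𝓝 p₀, ∀ w ∈ ((↑) ⁻¹' Metric.sphere (b₀ : ℂ) δ : Set U), ∀ x,
      ‖dslope (g p x) (a p) w‖ ≤ C := by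
    refine hS.induction_on (p := fun T => ∃ C, ∀ᶠ p in 𝓝 p₀, ∀ w ∈ T, ∀ x,
      ‖dslope (g p x) (a p) w‖ ≤ C) ⟨0, by simp⟩ ?_ ?_ ?_
    · rintro s t hst ⟨C, hC⟩
      exact ⟨C, hC.mono fun p hp w hw => hp w (hst hw)⟩
    · rintro s t ⟨C₁, h1⟩ ⟨C₂, h2⟩
      refine ⟨max C₁ C₂, ?_⟩
      filter_upwards [h1, h2] with p hp1 hp2 w hw x
      rcases hw with hw | hw
      · exact (hp1 w hw x).trans (le_max_left _ _)
      · exact (hp2 w hw x).trans (le_max_right _ _)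
    · intro w hw
      have hwne : w ≠ a p₀ := by
        rintro rfl
        rw [← hb, Set.mem_preimage, Metric.mem_sphere, dist_self] at hw
        exact hδ.ne hw
      obtain ⟨C, hC⟩ := hoff p₀ w hwne
      rw [nhds_prod_eq] at hC
      obtain ⟨s, hs, t, ht, hst⟩ := Filter.eventually_prod_iff.mp hC
      exact ⟨{w | t w}, mem_nhdsWithin_of_mem_nhds ht, C,
        hs.mono fun p hp w hw => hst hp hw⟩
  obtain ⟨C, hC⟩ := hunif
  have hnear : ∀ᶠ b : U in 𝓝 b₀, (b : ℂ) ∈ Metric.closedBall (b₀ : ℂ) δ :=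
    continuous_subtype_val.continuousAt.eventually (Metric.closedBall_mem_nhds _ hδ)
  refine ⟨C, ?_⟩
  rw [nhds_prod_eq]
  filter_upwards [hC.prod_mk hnear] with y hy x
  have hdiff : DiffContOnCl ℂ (dslope (g y.1 x) (a y.1)) (Metric.ball (b₀ : ℂ) δ) := by
    refine DifferentiableOn.diffContOnCl ?_
    rw [closure_ball _ hδ.ne']
    exact (hdd _ _).mono hball
  refine Complex.norm_le_of_forall_mem_frontier_norm_le Metric.isBounded_ball hdiff
    (fun w hw => ?_) (by rw [closure_ball _ hδ.ne']; exact hy.2)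
  rw [frontier_ball _ hδ.ne'] at hw
  exact hy.1 ⟨w, hsph w hw⟩ hw x

/-- Iterated divided differences: `dividedDiff f a n b` is `f[a 0, …, a (n - 1), b]`. -/
noncomputable def dividedDiff (f : ℂ → ℂ) (a : ℕ → ℂ) : ℕ → ℂ → ℂ
  | 0 => f
  | n + 1 => dslope (dividedDiff f a n) (a n)

lemma newton_interpolation (f : ℂ → ℂ) (a : ℕ → ℂ) (n : ℕ) (b : ℂ) :
    f b = ∑ i ∈ Finset.range n, dividedDiff f a i (a i) * ∏ l ∈ Finset.range i, (b - a l) +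
      dividedDiff f a n b * ∏ l ∈ Finset.range n, (b - a l) := by
  induction n with
  | zero => simp [dividedDiff]
  | succ n ih =>
    have h := sub_smul_dslope (dividedDiff f a n) (a n) b
    rw [smul_eq_mul] at h
    rw [Finset.sum_range_succ, Finset.prod_range_succ, dividedDiff]
    conv_lhs => rw [ih]
    linear_combination (-∏ l ∈ Finset.range n, (b - a l)) * h

/-- The change of basis from divided differences to values, with its determinant. -/
lemma exists_newton_matrix {p : ℕ} (v : Fin p → ℂ) {a : ℕ → ℂ} (ha : ∀ i : Fin p, a i = v i) :
    ∃ N : Matrix (Fin p) (Fin p) ℂ, N.det = (Matrix.vandermonde v).det ∧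
      ∀ (f : ℂ → ℂ) (j : Fin p), f (v j) = ∑ i : Fin p, dividedDiff f a i (v i) * N i j := by
  set N : Matrix (Fin p) (Fin p) ℂ :=
    Matrix.of fun i j => ∏ l ∈ Finset.range (i : ℕ), (v j - a l) with hN
  -- For `j < i` the Newton polynomial contains the factor `v j - a j`, so `N` is upper triangular
  -- and its diagonal multiplies to the Vandermonde product.
  have hzero : ∀ i j : Fin p, j < i → N i j = 0 := by
    intro i j hij
    exact Finset.prod_eq_zero (Finset.mem_range.mpr (Fin.lt_def.mp hij)) (by rw [ha, sub_self])
  refine ⟨N, ?_, fun f j => ?_⟩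
  swap
  · rw [newton_interpolation f a p (v j),
      Finset.prod_eq_zero (Finset.mem_range.mpr j.2) (by rw [ha, sub_self]), mul_zero, add_zero,
      ← Fin.sum_univ_eq_sum_range (fun i => dividedDiff f a i (a i) *
        ∏ l ∈ Finset.range i, (v j - a l))]
    exact Finset.sum_congr rfl fun i _ => by rw [hN, Matrix.of_apply, ha]
  rw [Matrix.det_of_isUpperTriangular (fun i j hij => hzero i j hij),
    Matrix.det_vandermonde]
  have h1 : ∀ i : Fin p, N i i = ∏ l ∈ Finset.Iio i, (v i - v l) := by
    intro i
    rw [hN, Matrix.of_apply, Finset.prod_range]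
    refine Finset.prod_bij (fun (l : Fin i) _ => (⟨l, l.2.trans i.2⟩ : Fin p)) ?_ ?_ ?_ ?_
    · intro l _
      simp [Fin.lt_def]
    · intro l _ l' _ h
      simpa [Fin.ext_iff] using h
    · intro l hl
      exact ⟨⟨l, Fin.lt_def.mp (Finset.mem_Iio.mp hl)⟩, Finset.mem_univ _, rfl⟩
    · intro l _
      rw [← ha ⟨l, _⟩]
  simp only [h1]
  refine Finset.prod_comm' fun i j => ?_
  simp

/-- This isolates the factor that vanishes at coinciding nodes; the other determinant keeps its
meaning there. -/
lemma det_eq_det_dividedDiff_mul_vandermonde {p : ℕ} (f : Fin p → ℂ → ℂ) (v : Fin p → ℂ)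
    {a : ℕ → ℂ} (ha : ∀ i : Fin p, a i = v i) :
    (Matrix.of fun k j => f k (v j)).det =
      (Matrix.of fun k (i : Fin p) => dividedDiff (f k) a i (v i)).det *
        (Matrix.vandermonde v).det := by
  obtain ⟨N, hN, h⟩ := exists_newton_matrix v ha
  rw [← hN, ← Matrix.det_mul]
  congr 1
  ext k j
  rw [Matrix.mul_apply]
  exact h (f k) j

lemma differentiableOn_dividedDiff {U : Set ℂ} (hU : IsOpen U) {f : ℂ → ℂ}
    (hf : DifferentiableOn ℂ f U) (a : ℕ → U) (n : ℕ) :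
    DifferentiableOn ℂ (dividedDiff f (fun i => a i) n) U := by
  induction n with
  | zero => exact hf
  | succ n ih => exact (Complex.differentiableOn_dslope (hU.mem_nhds (a n).2)).mpr ih

lemma continuous_dividedDiff {X : Type*} [TopologicalSpace X] {U : Set ℂ} (hU : IsOpen U)
    {f : X → ℂ → ℂ} (hd : ∀ x, DifferentiableOn ℂ (f x) U)
    (hc : Continuous fun y : X × U => f y.1 y.2) (n : ℕ) :
    Continuous fun y : ((ℕ → U) × X) × U => dividedDiff (f y.1.2) (fun i => y.1.1 i) n y.2 := by
  induction n with
  | zero => exact hc.comp ((continuous_snd.comp continuous_fst).prodMk continuous_snd)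
  | succ n ih =>
    exact continuous_dslope_of_continuous hU (P := (ℕ → U) × X)
      (g := fun q => dividedDiff (f q.2) (fun i => q.1 i) n) (a := fun q => q.1 n)
      ((continuous_apply n).comp continuous_fst)
      (fun q => differentiableOn_dividedDiff hU (hd q.2) q.1 n) ih

lemma eventually_bounded_dividedDiff {X : Type*} {U : Set ℂ} (hU : IsOpen U)
    {f : X → ℂ → ℂ} (hd : ∀ x, DifferentiableOn ℂ (f x) U)
    (hb : ∀ b : U, ∃ C, ∀ᶠ y : U in 𝓝 b, ∀ x, ‖f x y‖ ≤ C) (n : ℕ) (a : ℕ → U) (b : U) :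
    ∃ C, ∀ᶠ y : (ℕ → U) × U in 𝓝 (a, b), ∀ x,
      ‖dividedDiff (f x) (fun i => y.1 i) n y.2‖ ≤ C := by
  induction n generalizing a b with
  | zero =>
    obtain ⟨C, hC⟩ := hb b
    exact ⟨C, (continuous_snd.tendsto (a, b)).eventually hC⟩
  | succ n ih =>
    exact eventually_bounded_dslope hU (P := ℕ → U)
      (g := fun q x => dividedDiff (f x) (fun i => q i) n) (a := fun q => q n)
      (continuous_apply n) (fun q x => differentiableOn_dividedDiff hU (hd x) q n) ih a b

/-! ### Even functions of `s` as functions of `-s²` -/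

/-- The principal root serves off the open negative axis; on that axis `i √(-w)` replaces it. -/
lemma exists_continuousAt_sqrt (z : ℂ) :
    ∃ ρ : ℂ → ℂ, (∀ w, ρ w ^ 2 = w) ∧ ContinuousAt ρ z ∧ (z ≠ 0 → DifferentiableAt ℂ ρ z) := by
  by_cases hz : 0 ≤ z.re ∨ z.im ≠ 0
  · refine ⟨fun w => w ^ ((2 : ℕ) : ℂ)⁻¹, fun w => Complex.cpow_nat_inv_pow w two_ne_zero,
      Complex.continuousAt_cpow_const_of_re_pos hz (by norm_num), fun h0 => ?_⟩
    refine (differentiableAt_id).cpow_const ?_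
    rw [id, Complex.mem_slitPlane_iff]
    rcases hz with h | h
    · by_cases him : z.im = 0
      · refine Or.inl (lt_of_le_of_ne h fun h' => h0 (Complex.ext h'.symm him))
      · exact Or.inr him
    · exact Or.inr h
  · push Not at hz
    have hs : -z ∈ Complex.slitPlane := by
      rw [Complex.mem_slitPlane_iff]
      exact Or.inl (by simpa using hz.1)
    have hd : DifferentiableAt ℂ (fun w : ℂ => Complex.I * (-w) ^ ((2 : ℕ) : ℂ)⁻¹) z :=
      (DifferentiableAt.cpow_const (by fun_prop) hs).const_mul _
    refine ⟨fun w => Complex.I * (-w) ^ ((2 : ℕ) : ℂ)⁻¹, fun w => ?_, hd.continuousAt,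
      fun _ => hd⟩
    rw [mul_pow, Complex.cpow_nat_inv_pow _ two_ne_zero, Complex.I_sq]
    ring

lemma even_comp_eq_of_sq_eq {β : Type*} {f : ℂ → β} (hf : ∀ s, f (-s) = f s) {s t : ℂ}
    (h : s ^ 2 = t ^ 2) : f s = f t := by
  rcases sq_eq_sq_iff_eq_or_eq_neg.mp h with rfl | rfl
  · rfl
  · exact hf t

/-- An even function does not see the choice of root, so a branch adapted to each point may be used.
-/
lemma continuous_even_comp_sqrt {X : Type*} [TopologicalSpace X] {f : X → ℂ → ℂ}
    (hf : ∀ x s, f x (-s) = f x s) (hc : Continuous fun y : X × ℂ => f y.1 y.2) :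
    Continuous fun y : X × ℂ => f y.1 (y.2 ^ ((2 : ℕ) : ℂ)⁻¹) := by
  rw [continuous_iff_continuousAt]
  rintro ⟨x, z⟩
  obtain ⟨ρ, hρ, hρc, -⟩ := exists_continuousAt_sqrt z
  have h1 : (fun y : X × ℂ => f y.1 (y.2 ^ ((2 : ℕ) : ℂ)⁻¹)) = fun y => f y.1 (ρ y.2) := by
    funext y
    refine even_comp_eq_of_sq_eq (hf y.1) ?_
    rw [hρ, Complex.cpow_nat_inv_pow _ two_ne_zero]
  rw [h1]
  have h2 : ContinuousAt (fun y : X × ℂ => ρ y.2) (x, z) :=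
    ContinuousAt.comp (g := ρ) (f := Prod.snd) (x := (x, z)) hρc continuousAt_snd
  exact hc.continuousAt.comp (f := fun y : X × ℂ => (y.1, ρ y.2)) (x := (x, z))
    (continuousAt_fst.prodMk h2)

/-- Away from the origin a local branch of the root is holomorphic; the origin is a removable
singularity by continuity. -/
lemma differentiable_even_comp_sqrt {f : ℂ → ℂ} (hf : ∀ s, f (-s) = f s)
    (hd : Differentiable ℂ f) : Differentiable ℂ fun z : ℂ => f (z ^ ((2 : ℕ) : ℂ)⁻¹) := by
  have hcont : Continuous fun z : ℂ => f (z ^ ((2 : ℕ) : ℂ)⁻¹) :=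
    (continuous_even_comp_sqrt (X := Unit) (f := fun _ => f) (fun _ => hf)
      (hd.continuous.comp continuous_snd)).comp (Continuous.prodMk_right ())
  have hne : ∀ z : ℂ, z ≠ 0 → DifferentiableAt ℂ (fun z : ℂ => f (z ^ ((2 : ℕ) : ℂ)⁻¹)) z := by
    intro z hz
    obtain ⟨ρ, hρ, -, hρd⟩ := exists_continuousAt_sqrt z
    have h1 : (fun z : ℂ => f (z ^ ((2 : ℕ) : ℂ)⁻¹)) = fun z => f (ρ z) := by
      funext y
      refine even_comp_eq_of_sq_eq hf ?_
      rw [hρ, Complex.cpow_nat_inv_pow _ two_ne_zero]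
    rw [h1]
    exact (hd _).comp z (hρd hz)
  intro z
  rcases eq_or_ne z 0 with rfl | hz
  · refine (Complex.analyticAt_of_differentiable_on_punctured_nhds_of_continuousAt ?_
      hcont.continuousAt).differentiableAt
    filter_upwards [self_mem_nhdsWithin] with w hw using hne w hw
  · exact hne z hz

/-- The image of the strip `|Re s| < κ` under `s ↦ -s²`. -/
def parabolicRegion (κ : ℝ) : Set ℂ := {z | (‖z‖ - z.re) / 2 < κ ^ 2}

lemma isOpen_parabolicRegion (κ : ℝ) : IsOpen (parabolicRegion κ) :=
  isOpen_lt (by fun_prop) (by fun_prop)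

lemma norm_neg_sq_sub_re (s : ℂ) : (‖-s ^ 2‖ - (-s ^ 2).re) / 2 = s.re ^ 2 := by
  rw [norm_neg, norm_pow, ← Complex.normSq_eq_norm_sq, Complex.normSq_apply, Complex.neg_re, sq s,
    Complex.mul_re]
  ring

lemma neg_sq_mem_parabolicRegion {κ : ℝ} {s : ℂ} (h : |s.re| < κ) :
    -s ^ 2 ∈ parabolicRegion κ := by
  rw [parabolicRegion, Set.mem_ofPred_eq, norm_neg_sq_sub_re]
  exact sq_lt_sq.mpr (h.trans_le (le_abs_self κ))

/-- The function `₂F₁(r + s, r - s; 2r; -|x|)`, `2r = m + 1`, as a function of `z = -s²`, with its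
growth in the strip `|Re s| < κ` divided out. -/
noncomputable def spectralFun (m : ℕ) (κ : ℝ) (x : ℝ) (z : ℂ) : ℂ :=
  (((1 + |x|) ^ (((m : ℝ) + 1) / 2 - κ) : ℝ) : ℂ) * jacobiFun m ((-z) ^ ((2 : ℕ) : ℂ)⁻¹) |x|

lemma spectralFun_neg_sq (m : ℕ) (κ : ℝ) (x : ℝ) (s : ℂ) : spectralFun m κ x (-s ^ 2) =
    (((1 + |x|) ^ (((m : ℝ) + 1) / 2 - κ) : ℝ) : ℂ) * jacobiFun m s |x| := by
  rw [spectralFun]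
  congr 1
  refine even_comp_eq_of_sq_eq (f := fun s => jacobiFun m s |x|)
    (fun s => jacobiFun_neg m s (abs_nonneg x)) ?_
  rw [Complex.cpow_nat_inv_pow _ two_ne_zero, neg_neg]

lemma differentiable_spectralFun (m : ℕ) (κ x : ℝ) : Differentiable ℂ (spectralFun m κ x) := by
  unfold spectralFun
  refine Differentiable.const_mul ?_ _
  exact (differentiable_even_comp_sqrt (f := fun s => jacobiFun m s |x|)
    (fun s => jacobiFun_neg m s (abs_nonneg x))
    (differentiable_jacobiFun m (abs_nonneg x))).comp differentiable_neg

lemma continuous_spectralFun (m : ℕ) (κ : ℝ) :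
    Continuous fun y : ℝ × ℂ => spectralFun m κ y.1 y.2 := by
  unfold spectralFun
  refine Continuous.mul ?_ ?_
  · refine Complex.continuous_ofReal.comp (Continuous.rpow_const (by fun_prop) fun y => ?_)
    exact Or.inl (by positivity)
  · exact (continuous_even_comp_sqrt (X := ℝ) (f := fun x s => jacobiFun m s |x|)
      (fun x s => jacobiFun_neg m s (abs_nonneg x))
      ((continuous_jacobiFun_abs m).comp continuous_swap)).comp
      (continuous_fst.prodMk continuous_snd.neg)

/-- Near `b` the strip can be narrowed to some `κ' < κ`; the gap `κ - κ'` is the `ε` that absorbs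
the logarithm. -/
lemma eventually_bounded_spectralFun (m : ℕ) {κ : ℝ} (hκ : 0 < κ) (b : parabolicRegion κ) :
    ∃ C, ∀ᶠ z : parabolicRegion κ in 𝓝 b, ∀ x, ‖spectralFun m κ x z‖ ≤ C := by
  have hb : (‖(b : ℂ)‖ - (b : ℂ).re) / 2 < κ ^ 2 := b.2
  obtain ⟨κ', hκ'0, hκ'1, hκ'2⟩ : ∃ κ' : ℝ, 0 < κ' ∧ κ' < κ ∧
      (‖(b : ℂ)‖ - (b : ℂ).re) / 2 < κ' ^ 2 := by
    have h0 : 0 ≤ (‖(b : ℂ)‖ - (b : ℂ).re) / 2 := by linarith [Complex.re_le_norm (b : ℂ)]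
    have h1 : √((‖(b : ℂ)‖ - (b : ℂ).re) / 2) < κ := (Real.sqrt_lt' hκ).mpr hb
    obtain ⟨κ', h2, h3⟩ := exists_between h1
    have h4 : 0 < κ' := (Real.sqrt_nonneg _).trans_lt h2
    exact ⟨κ', h4, h3, (Real.sqrt_lt' h4).mp h2⟩
  obtain ⟨C, hC0, hC⟩ := exists_norm_jacobiFun_le m (‖(b : ℂ)‖ + 1) (ε := κ - κ') (by linarith)
  refine ⟨C, ?_⟩
  have h1 : ∀ᶠ z : parabolicRegion κ in 𝓝 b, (‖(z : ℂ)‖ - (z : ℂ).re) / 2 < κ' ^ 2 :=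
    ContinuousAt.eventually_lt (by fun_prop) continuousAt_const hκ'2
  have h2 : ∀ᶠ z : parabolicRegion κ in 𝓝 b, ‖(z : ℂ)‖ < ‖(b : ℂ)‖ + 1 :=
    ContinuousAt.eventually_lt (by fun_prop) continuousAt_const (by linarith)
  filter_upwards [h1, h2] with z hz1 hz2 x
  obtain ⟨s, hs⟩ : ∃ s : ℂ, (z : ℂ) = -s ^ 2 :=
    ⟨(-(z : ℂ)) ^ ((2 : ℕ) : ℂ)⁻¹, by rw [Complex.cpow_nat_inv_pow _ two_ne_zero, neg_neg]⟩
  rw [hs, norm_neg_sq_sub_re] at hz1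
  have hre : |s.re| < κ' := abs_lt_of_sq_lt_sq hz1 hκ'0.le
  have hsn : ‖s‖ ≤ ‖(b : ℂ)‖ + 1 := by
    rw [hs, norm_neg, norm_pow] at hz2
    nlinarith [norm_nonneg s, norm_nonneg (b : ℂ)]
  have hx : 0 < 1 + |x| := by positivity
  rw [hs, spectralFun_neg_sq, norm_mul, Complex.norm_real, Real.norm_eq_abs,
    abs_of_pos (Real.rpow_pos_of_pos hx _)]
  refine (mul_le_mul_of_nonneg_left (hC s hsn |x| (abs_nonneg x)) (by positivity)).trans ?_
  rw [mul_left_comm, ← Real.rpow_add hx]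
  refine mul_le_of_le_one_right hC0 (Real.rpow_le_one_of_one_le_of_nonpos ?_ ?_)
  · linarith [abs_nonneg x]
  · linarith

/-! ### Andréief's identity -/

/-- **Andréief's identity**, with integrability. -/
lemma integrable_det_mul_det {p : ℕ} {μ : Measure ℝ} [SigmaFinite μ] {φ ψ : Fin p → ℝ → ℂ}
    (h : ∀ j i, Integrable (fun x => φ j x * ψ i x) μ) :
    Integrable (fun x : Fin p → ℝ => (Matrix.of fun k j => φ j (x k)).det *
      (Matrix.of fun k i => ψ i (x k)).det) (Measure.pi fun _ => μ) ∧
    ∫ x : Fin p → ℝ, (Matrix.of fun k j => φ j (x k)).det *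
      (Matrix.of fun k i => ψ i (x k)).det ∂(Measure.pi fun _ => μ) =
      p.factorial * (Matrix.of fun i j => ∫ x, φ j x * ψ i x ∂μ).det := by
  have hexp : ∀ x : Fin p → ℝ, (Matrix.of fun k j => φ j (x k)).det *
      (Matrix.of fun k i => ψ i (x k)).det = ∑ π : Equiv.Perm (Fin p), ∑ τ : Equiv.Perm (Fin p),
        ((Equiv.Perm.sign π : ℤ) : ℂ) * ((Equiv.Perm.sign τ : ℤ) : ℂ) *
          ∏ k, (φ (π k) (x k) * ψ (τ k) (x k)) := by
    intro x
    rw [← Matrix.det_transpose, Matrix.det_apply',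
      ← Matrix.det_transpose (Matrix.of fun k i => ψ i (x k)), Matrix.det_apply', Finset.sum_mul_sum]
    refine Finset.sum_congr rfl fun π _ => Finset.sum_congr rfl fun τ _ => ?_
    simp only [Matrix.transpose_apply, Matrix.of_apply, Finset.prod_mul_distrib]
    ring
  have hint : ∀ π τ : Equiv.Perm (Fin p), Integrable (fun x : Fin p → ℝ =>
      ((Equiv.Perm.sign π : ℤ) : ℂ) * ((Equiv.Perm.sign τ : ℤ) : ℂ) *
          ∏ k, (φ (π k) (x k) * ψ (τ k) (x k))) (Measure.pi fun _ => μ) := fun π τ =>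
    (Integrable.fintype_prod (f := fun k x => φ (π k) x * ψ (τ k) x)
      (fun k => h (π k) (τ k))).const_mul _
  simp only [hexp]
  refine ⟨integrable_finsetSum _ fun π _ => integrable_finsetSum _ fun τ _ => hint π τ, ?_⟩
  rw [integral_finsetSum _ fun π _ => integrable_finsetSum _ fun τ _ => hint π τ]
  have hinner : ∀ π : Equiv.Perm (Fin p), ∫ x : Fin p → ℝ, ∑ τ : Equiv.Perm (Fin p),
        ((Equiv.Perm.sign π : ℤ) : ℂ) * ((Equiv.Perm.sign τ : ℤ) : ℂ) *
          ∏ k, (φ (π k) (x k) * ψ (τ k) (x k)) ∂(Measure.pi fun _ => μ) =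
      (Matrix.of fun i j => ∫ x, φ j x * ψ i x ∂μ).det := by
    intro π
    rw [integral_finsetSum _ fun τ _ => hint π τ]
    rw [Matrix.det_apply']
    -- Replacing `τ` by `τ π⁻¹` shows that every `π` contributes the same determinant, whence the
    -- factor `p!`.
    refine Fintype.sum_equiv (Equiv.mulRight π⁻¹) _ _ fun τ => ?_
    rw [integral_const_mul, integral_fintype_prod_eq_prod (fun k x => φ (π k) x * ψ (τ k) x),
      Equiv.coe_mulRight, Equiv.Perm.sign_mul, Equiv.Perm.sign_inv,
      ← Equiv.prod_comp π⁻¹ fun k => ∫ x, φ (π k) x * ψ (τ k) x ∂μ]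
    simp [mul_comm]
  simp only [hinner, Finset.sum_const, Finset.card_univ, Fintype.card_perm, Fintype.card_fin,
    nsmul_eq_mul]

namespace MatrixBall

/-! ### Difference products and regular points -/

/-- With nodes `-s²` the two sign conventions agree. -/
lemma diffProd_sq_eq_det_vandermonde {R : Type*} [CommRing R] {p : ℕ} (s : Fin p → R) :
    diffProd (fun k => s k ^ 2) = (Matrix.vandermonde fun k => -s k ^ 2).det := by
  rw [Matrix.det_vandermonde, diffProd]
  exact Finset.prod_congr rfl fun k _ => Finset.prod_congr rfl fun l _ => by ring

/-- The differences are invariant under `x ↦ 1 + x`, and decreasing exponents give the right sign.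
Powers of `1 + x` are chosen because they merge with the factor `(1 + x) ^ (-α)`. -/
lemma diffProd_eq_det_one_add_pow {R : Type*} [CommRing R] {p : ℕ} (x : Fin p → R) :
    diffProd x = (Matrix.of fun k i : Fin p => (1 + x k) ^ (i.rev : ℕ)).det := by
  have h := Matrix.det_projVandermonde (1 : Fin p → R) (fun k => 1 + x k)
  have h2 : Matrix.projVandermonde (1 : Fin p → R) (fun k => 1 + x k) =
      Matrix.of fun k i : Fin p => (1 + x k) ^ (i.rev : ℕ) := by
    ext k i
    simp [Matrix.projVandermonde_apply]
  rw [← h2, h, diffProd]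
  exact Finset.prod_congr rfl fun k _ => Finset.prod_congr rfl fun l _ => by simp

lemma diffProd_ne_zero_iff {R : Type*} [CommRing R] [IsDomain R] {p : ℕ} {y : Fin p → R} :
    diffProd y ≠ 0 ↔ ∀ k l, k < l → y k ≠ y l := by
  simp [diffProd, Finset.prod_eq_zero_iff, sub_eq_zero]

lemma ae_diffProd_ne_zero (p : ℕ) : ∀ᵐ x : Fin p → ℝ, diffProd x ≠ 0 := by
  simp only [diffProd_ne_zero_iff]
  rw [ae_all_iff]
  intro k
  rw [ae_all_iff]
  intro l
  by_cases hkl : k < l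
  swap
  · simp [hkl]
  set E : Submodule ℝ (Fin p → ℝ) :=
    LinearMap.ker ((LinearMap.proj k : (Fin p → ℝ) →ₗ[ℝ] ℝ) - LinearMap.proj l) with hE
  have hne : E ≠ ⊤ := by
    intro h
    have h1 : Pi.single k (1 : ℝ) ∈ E := h ▸ Submodule.mem_top
    simp [hE, hkl.ne'] at h1
  have h0 := Measure.addHaar_submodule volume E hne
  filter_upwards [measure_eq_zero_iff_ae_notMem.mp h0] with x hx _ hxkl
  exact hx (by simp [hE, hxkl])

/-- Perturbing a spectral parameter along the direction `(1, 2, …, p)` makes it regular. -/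
lemma eventually_diffProd_sq_ne_zero {p : ℕ} (s : Fin p → ℂ) :
    ∀ᶠ t : ℂ in 𝓝[≠] 0, diffProd (fun k => (s k + t * ((k : ℕ) + 1)) ^ 2) ≠ 0 := by
  simp only [diffProd_ne_zero_iff]
  rw [Filter.eventually_all]
  intro k
  rw [Filter.eventually_all]
  intro l
  by_cases hkl : k < l
  swap
  · simp [hkl]
  -- The difference of squares factors into two affine functions of `t` with non-zero slopes.
  have hd : ((k : ℕ) : ℂ) - (l : ℕ) ≠ 0 :=
    sub_ne_zero.mpr (by exact_mod_cast (Fin.lt_def.mp hkl).ne)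
  have ha : ((k : ℕ) : ℂ) + 1 + ((l : ℕ) + 1) ≠ 0 := by
    have : (((k : ℕ) + 1 + ((l : ℕ) + 1) : ℕ) : ℂ) ≠ 0 := by
      exact Nat.cast_ne_zero.mpr (by omega)
    exact_mod_cast this
  have key : ∀ a b : ℂ, b ≠ 0 → ∀ᶠ t : ℂ in 𝓝[≠] 0, a + t * b ≠ 0 := by
    intro a b hb
    have h1 : ∀ᶠ t : ℂ in 𝓝[≠] 0, t ≠ -a / b := by
      by_cases h : -a / b = 0
      · rw [h]; exact self_mem_nhdsWithin
      · exact Filter.Eventually.filter_mono nhdsWithin_le_nhds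
          (isOpen_ne.mem_nhds (Ne.symm h))
    filter_upwards [h1] with t ht h0
    refine ht ?_
    rw [eq_div_iff hb]
    linear_combination h0
  filter_upwards [key (s k - s l) _ hd, key (s k + s l) _ ha] with t h1 h2 _ h
  have : (s k - s l + t * (((k : ℕ) : ℂ) - (l : ℕ))) *
      (s k + s l + t * (((k : ℕ) : ℂ) + 1 + ((l : ℕ) + 1))) = 0 := by
    linear_combination h
  exact (mul_ne_zero h1 h2) this

lemma continuous_shift {p : ℕ} (s : Fin p → ℂ) :
    Continuous fun t : ℂ => fun k : Fin p => s k + t * ((k : ℕ) + 1) := by fun_prop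

lemma mem_closure_regularSet {p : ℕ} (s : Fin p → ℂ) {x : Fin p → ℝ} (hx : diffProd x ≠ 0)
    (hx0 : ∀ k, 0 ≤ x k) : (s, x) ∈ closure (regularSet p) := by
  have h1 : Filter.Tendsto (fun t : ℂ => ((fun k : Fin p => s k + t * ((k : ℕ) + 1)), x)) (𝓝[≠] 0)
      (𝓝 (s, x)) := by
    have h2 := ((continuous_shift s).prodMk (continuous_const (y := x))).tendsto 0
    simp only [zero_mul, add_zero] at h2
    exact h2.mono_left nhdsWithin_le_nhds
  refine mem_closure_of_tendsto h1 ?_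
  filter_upwards [eventually_diffProd_sq_ne_zero s] with t ht using ⟨ht, hx, hx0⟩

/-! ### The spherical function as a determinant of divided differences -/

/-- The nodes `-s_j²`, extended by zero to a sequence. -/
def spectralNodes {p : ℕ} (s : Fin p → ℂ) (i : ℕ) : ℂ :=
  if h : i < p then -s ⟨i, h⟩ ^ 2 else 0

/-- The `j`-th divided difference, at the nodes `-s_0², …, -s_j²`, of the rescaled hypergeometric
function. -/
noncomputable def confluentFun {p : ℕ} (m : ℕ) (κ : ℝ) (s : Fin p → ℂ) (j : Fin p) (x : ℝ) : ℂ :=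
  dividedDiff (spectralFun m κ x) (spectralNodes s) j (-s j ^ 2)

/-- The tube `|Re s_k| < κ`. -/
def tube (p : ℕ) (κ : ℝ) : Set (Fin p → ℂ) := {s | ∀ k, |(s k).re| < κ}

lemma isOpen_tube (p : ℕ) (κ : ℝ) : IsOpen (tube p κ) := by
  simp only [tube, Set.ofPred_forall]
  exact isOpen_iInter_of_finite fun k => isOpen_lt (by fun_prop) (by fun_prop)

lemma spectralNodes_mem {p : ℕ} {κ : ℝ} (hκ : 0 < κ) {s : Fin p → ℂ} (hs : s ∈ tube p κ) (i : ℕ) :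
    spectralNodes s i ∈ parabolicRegion κ := by
  unfold spectralNodes
  split_ifs with h
  · exact neg_sq_mem_parabolicRegion (hs _)
  -- The padding value `0` lies in the region because `κ` is positive.
  · simp [parabolicRegion, hκ]

lemma continuous_spectralNodes {p : ℕ} (i : ℕ) :
    Continuous fun s : Fin p → ℂ => spectralNodes s i := by
  unfold spectralNodes
  split_ifs with h
  · fun_prop
  · exact continuous_const

lemma continuousOn_confluentFun {p : ℕ} (m : ℕ) {κ : ℝ} (hκ : 0 < κ) (j : Fin p) :
    ContinuousOn (fun y : (Fin p → ℂ) × ℝ => confluentFun m κ y.1 j y.2)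
      (tube p κ ×ˢ Set.univ) := by
  rw [continuousOn_iff_continuous_domRestrict]
  have h := continuous_dividedDiff (isOpen_parabolicRegion κ)
    (fun x => (differentiable_spectralFun m κ x).differentiableOn)
    ((continuous_spectralFun m κ).comp
      (continuous_fst.prodMk (continuous_subtype_val.comp continuous_snd))) j
  refine h.comp (f := fun y : (tube p κ ×ˢ Set.univ : Set ((Fin p → ℂ) × ℝ)) =>
    (((fun i => (⟨spectralNodes y.1.1 i, spectralNodes_mem hκ y.2.1 i⟩ : parabolicRegion κ)),
      y.1.2), (⟨-y.1.1 j ^ 2, neg_sq_mem_parabolicRegion (y.2.1 j)⟩ : parabolicRegion κ))) ?_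
  refine Continuous.prodMk (Continuous.prodMk (continuous_pi fun i => ?_) ?_) ?_
  · exact ((continuous_spectralNodes i).comp
      (continuous_fst.comp continuous_subtype_val)).subtype_mk _
  · fun_prop
  · exact Continuous.subtype_mk (by fun_prop) _

lemma eventually_bounded_confluentFun {p : ℕ} (m : ℕ) {κ : ℝ} (hκ : 0 < κ) (j : Fin p)
    {s₀ : Fin p → ℂ} (hs₀ : s₀ ∈ tube p κ) :
    ∃ C, ∀ᶠ s in 𝓝 s₀, ∀ x, ‖confluentFun m κ s j x‖ ≤ C := by
  obtain ⟨C, hC⟩ := eventually_bounded_dividedDiff (isOpen_parabolicRegion κ)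
    (fun x => (differentiable_spectralFun m κ x).differentiableOn)
    (eventually_bounded_spectralFun m hκ) j
    (fun i => (⟨spectralNodes s₀ i, spectralNodes_mem hκ hs₀ i⟩ : parabolicRegion κ))
    (⟨-s₀ j ^ 2, neg_sq_mem_parabolicRegion (hs₀ j)⟩ : parabolicRegion κ)
  refine ⟨C, ?_⟩
  have hc : Continuous fun s : tube p κ =>
      ((fun i => (⟨spectralNodes s.1 i, spectralNodes_mem hκ s.2 i⟩ : parabolicRegion κ)),
      (⟨-s.1 j ^ 2, neg_sq_mem_parabolicRegion (s.2 j)⟩ : parabolicRegion κ)) := by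
    refine Continuous.prodMk (continuous_pi fun i => ?_) ?_
    · exact ((continuous_spectralNodes i).comp continuous_subtype_val).subtype_mk _
    · exact (((continuous_apply j).comp continuous_subtype_val).pow 2).neg.subtype_mk _
  have h1 := (hc.tendsto ⟨s₀, hs₀⟩).eventually hC
  rw [nhds_subtype_eq_comap, Filter.eventually_comap] at h1
  filter_upwards [h1, (isOpen_tube p κ).mem_nhds hs₀] with s hs hst
  exact hs ⟨s, hst⟩ rfl

lemma rParam_add (p m : ℕ) : rParam p (p + m) = ((m : ℂ) + 1) / 2 := by
  rw [rParam]; push_cast; ring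

lemma hParam_add (p m : ℕ) : hParam p (p + m) = (2 * (p : ℝ) + m - 1) / 2 := by
  rw [hParam]; push_cast; ring

/-- The growth is taken out row by row and the Vandermonde factor by divided differences. Nothing is
divided by, so coinciding `s_k²` are allowed. -/
lemma det_hypergeometricFun {p : ℕ} (m : ℕ) (κ : ℝ) (s : Fin p → ℂ) {x : Fin p → ℝ}
    (hx : ∀ k, 0 ≤ x k) :
    (Matrix.of fun k j : Fin p => hypergeometricFun (rParam p (p + m) + s j)
      (rParam p (p + m) - s j) (((p + m : ℕ) : ℂ) - p + 1) (-(x k))).det =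
    (∏ k, (((1 + x k) ^ (κ - ((m : ℝ) + 1) / 2) : ℝ) : ℂ)) *
      (Matrix.of fun k j => confluentFun m κ s j (x k)).det * diffProd (fun k => s k ^ 2) := by
  have h1 : ∀ k j : Fin p, hypergeometricFun (rParam p (p + m) + s j)
      (rParam p (p + m) - s j) (((p + m : ℕ) : ℂ) - p + 1) (-(x k)) =
      (((1 + x k) ^ (κ - ((m : ℝ) + 1) / 2) : ℝ) : ℂ) * spectralFun m κ (x k) (-s j ^ 2) := by
    intro k j
    have h0 : 0 < 1 + x k := by linarith [hx k]
    rw [rParam_add, show ((p + m : ℕ) : ℂ) - p + 1 = (m : ℂ) + 1 by push_cast; ring,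
      hypergeometricFun_eq_jacobiFun m (s j) (hx k), spectralFun_neg_sq, abs_of_nonneg (hx k),
      ← mul_assoc, ← Complex.ofReal_mul, ← Real.rpow_add h0]
    simp
  simp only [h1]
  have h2 := Matrix.det_mul_column (fun k => (((1 + x k) ^ (κ - ((m : ℝ) + 1) / 2) : ℝ) : ℂ))
    (Matrix.of fun k j => spectralFun m κ (x k) (-s j ^ 2))
  simp only [Matrix.of_apply] at h2
  rw [h2, det_eq_det_dividedDiff_mul_vandermonde (fun k => spectralFun m κ (x k))
    (fun j => -s j ^ 2) (a := spectralNodes s) (fun i => by simp [spectralNodes]),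
    diffProd_sq_eq_det_vandermonde, mul_assoc]
  rfl

/-- The normalising constant of the spherical function. -/
noncomputable def sphericalConst (p m : ℕ) : ℂ :=
  ∏ n ∈ Finset.range p, ((n.factorial : ℂ) * ((m + 1).ascFactorial n : ℂ))

/-- The right-hand side equals the quotient on the regular set and is continuous at `(s, x)` even if
some `s_k²` coincide, so it is the value of the extension. -/
lemma sphericalFunction_eq {p : ℕ} (m : ℕ) {κ : ℝ} (hκ : 0 < κ) {s : Fin p → ℂ}
    (hs : s ∈ tube p κ) {x : Fin p → ℝ} (hx : ∀ k, 0 ≤ x k) (hxd : diffProd x ≠ 0) :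
    sphericalFunction p (p + m) s x = sphericalConst p m *
      ((∏ k, (((1 + x k) ^ (κ - ((m : ℝ) + 1) / 2) : ℝ) : ℂ)) *
        (Matrix.of fun k j => confluentFun m κ s j (x k)).det) / ((diffProd x : ℝ) : ℂ) := by
  refine extendFrom_eq (mem_closure_regularSet s hxd hx) ?_
  have hcont : ContinuousWithinAt (fun y : (Fin p → ℂ) × (Fin p → ℝ) => sphericalConst p m *
      ((∏ k, (((1 + y.2 k) ^ (κ - ((m : ℝ) + 1) / 2) : ℝ) : ℂ)) *
        (Matrix.of fun k j => confluentFun m κ y.1 j (y.2 k)).det) / ((diffProd y.2 : ℝ) : ℂ))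
      (regularSet p) (s, x) := by
    refine ContinuousAt.continuousWithinAt ?_
    refine ContinuousAt.div (ContinuousAt.mul continuousAt_const (ContinuousAt.mul ?_ ?_)) ?_
      (by exact_mod_cast hxd)
    · refine tendsto_finsetProd _ fun k _ => ?_
      refine Complex.continuous_ofReal.continuousAt.comp (ContinuousAt.rpow_const ?_ ?_)
      · fun_prop
      · exact Or.inl (by simp only; linarith [hx k])
    · have hentry : ∀ k j : Fin p, ContinuousAt (fun y : (Fin p → ℂ) × (Fin p → ℝ) =>
          confluentFun m κ y.1 j (y.2 k)) (s, x) := by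
        intro k j
        have h1 := (continuousOn_confluentFun m hκ j).continuousAt (x := (s, x k))
          (((isOpen_tube p κ).prod isOpen_univ).mem_nhds ⟨hs, trivial⟩)
        exact h1.comp (f := fun y : (Fin p → ℂ) × (Fin p → ℝ) => (y.1, y.2 k)) (x := (s, x))
          (by fun_prop)
      simp only [Matrix.det_apply', Matrix.of_apply]
      refine tendsto_finsetSum _ fun π _ => Filter.Tendsto.mul tendsto_const_nhds ?_
      exact tendsto_finsetProd _ fun k _ => hentry _ _
    · refine Complex.continuous_ofReal.continuousAt.comp ?_
      refine Continuous.continuousAt ?_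
      unfold diffProd
      fun_prop
  refine hcont.tendsto.congr' ?_
  filter_upwards [self_mem_nhdsWithin] with y hy
  obtain ⟨h1, h2, h3⟩ := hy
  have h2' : ((diffProd y.2 : ℝ) : ℂ) ≠ 0 := by exact_mod_cast h2
  rw [sphericalQuotient, det_hypergeometricFun m κ y.1 h3, sphericalConst, Nat.add_sub_cancel_left]
  field_simp

/-! ### Reduction of the transform to one-variable integrals -/

/-- The one-variable weight that a power of `1 + x` contributes to the spherical transform. -/
noncomputable def rankOneWeight (m : ℕ) (κ : ℝ) (α : ℂ) (x : ℝ) : ℂ :=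
  (x : ℂ) ^ m * (1 + (x : ℂ)) ^ (-α) * (((1 + x) ^ (κ - ((m : ℝ) + 1) / 2) : ℝ) : ℂ)

/-- The weighted monomials that are integrated against the spherical functions. -/
noncomputable def weightedMonomial {p : ℕ} (m : ℕ) (κ : ℝ) (α : ℂ) (i : Fin p) (x : ℝ) : ℂ :=
  rankOneWeight m κ α x * (1 + (x : ℂ)) ^ (i.rev : ℕ)

lemma sphericalIntegrand_eq {p : ℕ} (m : ℕ) {κ : ℝ} (hκ : 0 < κ) (α : ℂ) {s : Fin p → ℂ}
    (hs : s ∈ tube p κ) {x : Fin p → ℝ} (hx : ∀ k, 0 ≤ x k) (hxd : diffProd x ≠ 0) :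
    sphericalIntegrand p (p + m) (berezinFunction p α) s x = sphericalConst p m *
      ((Matrix.of fun k j => confluentFun m κ s j (x k)).det *
        (Matrix.of fun k i => weightedMonomial m κ α i (x k)).det) := by
  have hxd' : ((diffProd x : ℝ) : ℂ) ≠ 0 := by exact_mod_cast hxd
  have hD : ((diffProd x : ℝ) : ℂ) =
      (Matrix.of fun k i : Fin p => (1 + (x k : ℂ)) ^ (i.rev : ℕ)).det := by
    rw [← diffProd_eq_det_one_add_pow fun k => (x k : ℂ)]
    simp [diffProd]
  have hψ := Matrix.det_mul_column (fun k => rankOneWeight m κ α (x k))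
    (Matrix.of fun k i : Fin p => (1 + (x k : ℂ)) ^ (i.rev : ℕ))
  simp only [Matrix.of_apply] at hψ
  have hψ' : (Matrix.of fun k i => weightedMonomial m κ α i (x k)).det =
      (∏ k, rankOneWeight m κ α (x k)) * ((diffProd x : ℝ) : ℂ) := by rw [hD, ← hψ]; rfl
  rw [sphericalIntegrand, sphericalFunction_eq m hκ hs hx hxd, hψ', berezinFunction, radialWeight,
    Nat.add_sub_cancel_left]
  simp only [rankOneWeight, Finset.prod_mul_distrib]
  push_cast
  field_simp

lemma volume_restrict_Ici_zero (p : ℕ) : (volume : Measure (Fin p → ℝ)).restrict (Set.Ici 0) =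
    Measure.pi fun _ => (volume : Measure ℝ).restrict (Set.Ici 0) := by
  rw [← Measure.restrict_pi_pi, ← volume_pi]
  congr 1
  exact (Set.pi_univ_Ici (0 : Fin p → ℝ)).symm

lemma ae_sphericalIntegrand_eq {p : ℕ} (m : ℕ) {κ : ℝ} (hκ : 0 < κ) (α : ℂ) {s : Fin p → ℂ}
    (hs : s ∈ tube p κ) : ∀ᵐ x ∂((volume : Measure (Fin p → ℝ)).restrict (Set.Ici 0)),
      sphericalIntegrand p (p + m) (berezinFunction p α) s x = sphericalConst p m *
      ((Matrix.of fun k j => confluentFun m κ s j (x k)).det *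
        (Matrix.of fun k i => weightedMonomial m κ α i (x k)).det) := by
  filter_upwards [ae_restrict_of_ae (ae_diffProd_ne_zero p), ae_restrict_mem measurableSet_Ici]
    with x h1 h2
  exact sphericalIntegrand_eq m hκ α hs (fun k => h2 k) h1

lemma norm_weightedMonomial_le {p : ℕ} (m : ℕ) (κ : ℝ) (α : ℂ) (i : Fin p) {x : ℝ} (hx : 0 ≤ x) :
    ‖weightedMonomial m κ α i x‖ ≤
      (1 + x) ^ ((m : ℝ) - α.re + (κ - ((m : ℝ) + 1) / 2) + ((p : ℝ) - 1)) := by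
  have h1 : 0 < 1 + x := by linarith
  have h2 := norm_pow_mul_one_add_cpow_le m α hx
  have h3 : ‖(1 + (x : ℂ)) ^ (i.rev : ℕ)‖ ≤ (1 + x) ^ ((p : ℝ) - 1) := by
    rw [← Complex.cpow_natCast, norm_one_add_cpow hx]
    refine Real.rpow_le_rpow_of_exponent_le (by linarith) ?_
    have : (i.rev : ℕ) + 1 ≤ p := i.rev.2
    have h4 : ((i.rev : ℕ) : ℝ) + 1 ≤ p := by exact_mod_cast this
    rw [Complex.natCast_re]
    linarith
  rw [weightedMonomial, rankOneWeight, norm_mul, norm_mul, Complex.norm_real, Real.norm_eq_abs,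
    abs_of_pos (Real.rpow_pos_of_pos h1 _), Real.rpow_add h1, Real.rpow_add h1]
  gcongr

lemma continuousOn_weightedMonomial {p : ℕ} (m : ℕ) (κ : ℝ) (α : ℂ) (i : Fin p) :
    ContinuousOn (weightedMonomial m κ α i) (Set.Ici 0) := by
  unfold weightedMonomial rankOneWeight
  refine ContinuousOn.mul (ContinuousOn.mul (ContinuousOn.mul (by fun_prop)
    (continuousOn_one_add_cpow _)) ?_) (by fun_prop)
  refine Complex.continuous_ofReal.comp_continuousOn (ContinuousOn.rpow_const (by fun_prop) ?_)
  intro x hx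
  exact Or.inl (by linarith [Set.mem_Ici.mp hx])

lemma continuousOn_confluentFun_apply {p : ℕ} (m : ℕ) {κ : ℝ} (hκ : 0 < κ) {s : Fin p → ℂ}
    (hs : s ∈ tube p κ) (j : Fin p) : Continuous (confluentFun m κ s j) := by
  have h := (continuousOn_confluentFun m hκ j).comp_continuous
    (f := fun x : ℝ => (s, x)) (by fun_prop) (fun x => ⟨hs, trivial⟩)
  exact h

lemma integrable_confluentFun_mul_weightedMonomial {p : ℕ} (m : ℕ) {κ : ℝ} (hκ : 0 < κ) {α : ℂ}
    (hα : κ < α.re - hParam p (p + m)) {s : Fin p → ℂ} (hs : s ∈ tube p κ) (j i : Fin p) :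
    Integrable (fun x => confluentFun m κ s j x * weightedMonomial m κ α i x)
      (volume.restrict (Set.Ici (0 : ℝ))) := by
  obtain ⟨C, hC⟩ := eventually_bounded_confluentFun m hκ j hs
  have hb := hC.self_of_nhds
  rw [hParam_add] at hα
  -- The exponent `a` equals `κ - (Re α - h) - 1`, so `a < -1` is exactly the hypothesis on `κ`.
  refine (integrableOn_Ici_iff_integrableOn_Ioi (μ := volume)).mpr
    (integrableOn_Ioi_of_norm_le_one_add_rpow (C := C)
      (a := (m : ℝ) - α.re + (κ - ((m : ℝ) + 1) / 2) + ((p : ℝ) - 1)) ?_ (by linarith) ?_)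
  · exact (continuousOn_confluentFun_apply m hκ hs j).continuousOn.mul
      ((continuousOn_weightedMonomial m κ α i).mono Set.Ioi_subset_Ici_self)
  · intro x hx
    rw [norm_mul]
    exact mul_le_mul (hb x) (norm_weightedMonomial_le m κ α i hx.le) (norm_nonneg _)
      ((norm_nonneg _).trans (hb x))

/-- The matrix of one-variable integrals to which the spherical transform reduces. -/
noncomputable def momentMatrix {p : ℕ} (m : ℕ) (κ : ℝ) (α : ℂ) (s : Fin p → ℂ) :
    Matrix (Fin p) (Fin p) ℂ :=
  Matrix.of fun i j => ∫ x in Set.Ici (0 : ℝ), confluentFun m κ s j x * weightedMonomial m κ α i x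

lemma sphericalConst_mul {p m : ℕ} : ((p.factorial : ℂ) *
      ∏ n ∈ Finset.range p, ((n.factorial : ℂ) * ((m + n).factorial : ℂ)))⁻¹ *
      (sphericalConst p m * p.factorial) = ((m.factorial : ℂ) ^ p)⁻¹ := by
  have hf : ∀ n : ℕ, (n.factorial : ℂ) ≠ 0 := fun n => by exact_mod_cast n.factorial_ne_zero
  have h1 : ∏ n ∈ Finset.range p, ((n.factorial : ℂ) * ((m + n).factorial : ℂ)) =
      (m.factorial : ℂ) ^ p * sphericalConst p m := by
    rw [sphericalConst, ← Finset.card_range p, ← Finset.prod_const, Finset.card_range,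
      ← Finset.prod_mul_distrib]
    refine Finset.prod_congr rfl fun n _ => ?_
    rw [← Nat.factorial_mul_ascFactorial]
    push_cast
    ring
  have h2 : sphericalConst p m ≠ 0 := by
    refine Finset.prod_ne_zero_iff.mpr fun n _ => mul_ne_zero (hf n) ?_
    exact Nat.cast_ne_zero.mpr (Nat.ascFactorial_pos m n).ne'
  have := hf p
  have := hf m
  rw [h1]
  field_simp

/-- Andréief's identity applied to divided differences and weighted monomials. For `p = 0` there are
no one-variable integrals, so the condition on `α` is asked only when `0 < p`. -/
lemma sphericalTransform_eq_det {p : ℕ} (m : ℕ) {κ : ℝ} (hκ : 0 < κ) {α : ℂ}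
    (hα : 0 < p → κ < α.re - hParam p (p + m)) {s : Fin p → ℂ} (hs : s ∈ tube p κ) :
    IntegrableOn (sphericalIntegrand p (p + m) (berezinFunction p α) s) (Set.Ici 0) ∧
    sphericalTransform p (p + m) (berezinFunction p α) s =
      ((m.factorial : ℂ) ^ p)⁻¹ * (momentMatrix m κ α s).det := by
  have hA := integrable_det_mul_det
    (fun j i => integrable_confluentFun_mul_weightedMonomial m hκ (hα i.pos) hs j i)
  rw [← volume_restrict_Ici_zero] at hA
  have hae := ae_sphericalIntegrand_eq m hκ α hs
  refine ⟨(hA.1.const_mul (sphericalConst p m)).congr (hae.mono fun x hx => hx.symm), ?_⟩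
  rw [sphericalTransform, integral_congr_ae hae, integral_const_mul, hA.2,
    Nat.add_sub_cancel_left, ← sphericalConst_mul, momentMatrix]
  ring

/-- Dominated convergence entry by entry: near `s₀` the divided differences have a bound independent
of `s` and `x`. -/
lemma continuousAt_det_momentMatrix {p : ℕ} (m : ℕ) {κ : ℝ} (hκ : 0 < κ) {α : ℂ}
    (hα : 0 < p → κ < α.re - hParam p (p + m)) {s₀ : Fin p → ℂ} (hs₀ : s₀ ∈ tube p κ) :
    ContinuousAt (fun s => (momentMatrix m κ α s).det) s₀ := by
  have hentry : ∀ i j : Fin p, ContinuousAt (fun s => momentMatrix m κ α s i j) s₀ := by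
    intro i j
    obtain ⟨C, hC⟩ := eventually_bounded_confluentFun m hκ j hs₀
    have htube := (isOpen_tube p κ).mem_nhds hs₀
    have hα := hα i.pos
    rw [hParam_add] at hα
    refine continuousAt_of_dominated
      (bound := fun x => C *
        (1 + x) ^ ((m : ℝ) - α.re + (κ - ((m : ℝ) + 1) / 2) + ((p : ℝ) - 1))) ?_ ?_ ?_ ?_
    · filter_upwards [htube] with s hs
      exact ((continuousOn_confluentFun_apply m hκ hs j).continuousOn.mul
        (continuousOn_weightedMonomial m κ α i)).aestronglyMeasurable measurableSet_Ici
    · filter_upwards [hC] with s hs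
      filter_upwards [ae_restrict_mem measurableSet_Ici] with x hx
      rw [norm_mul]
      exact mul_le_mul (hs x) (norm_weightedMonomial_le m κ α i hx) (norm_nonneg _)
        ((norm_nonneg _).trans (hs x))
    · refine (integrableOn_Ici_iff_integrableOn_Ioi (μ := volume)).mpr ?_
      have := (integrableOn_add_rpow_Ioi_of_lt (m := 1) (c := 0)
        (a := (m : ℝ) - α.re + (κ - ((m : ℝ) + 1) / 2) + ((p : ℝ) - 1)) (by linarith)
        (by norm_num)).const_mul C
      simp only [add_comm _ (1 : ℝ)] at this ⊢
      exact this
    · refine Filter.Eventually.of_forall fun x => ContinuousAt.mul ?_ continuousAt_const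
      have h1 := (continuousOn_confluentFun m hκ j).continuousAt (x := (s₀, x))
          (((isOpen_tube p κ).prod isOpen_univ).mem_nhds ⟨hs₀, trivial⟩)
      exact h1.comp (f := fun s : Fin p → ℂ => (s, x)) (x := s₀) (by fun_prop)
  simp only [Matrix.det_apply']
  refine tendsto_finsetSum _ fun π _ => Filter.Tendsto.mul tendsto_const_nhds ?_
  exact tendsto_finsetProd _ fun k _ => hentry _ _

/-! ### Evaluation of the determinant -/

/-- The rank-one transform at `σ = α - i.rev`. Since `i.rev + 1 + i = p`, one has `σ - r = α - h +
i`; the two growth factors in `κ` cancel. -/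
lemma integral_spectralFun_mul_weightedMonomial {p : ℕ} (m : ℕ) {κ : ℝ} {α : ℂ}
    (hα : κ < α.re - hParam p (p + m)) {s : ℂ} (hs : |s.re| < κ) (i : Fin p) :
    ∫ x in Set.Ici (0 : ℝ), spectralFun m κ x (-s ^ 2) * weightedMonomial m κ α i x =
      m.factorial * (Complex.Gamma (α - hParam p (p + m) + s + i) *
        Complex.Gamma (α - hParam p (p + m) - s + i)) / Complex.Gamma (α - (i.rev : ℕ)) ^ 2 := by
  have hrev : (i.rev : ℕ) + 1 + i = p := by rw [Fin.val_rev]; omega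
  have hrevR : ((i.rev : ℕ) : ℝ) + 1 + (i : ℕ) = p := by exact_mod_cast hrev
  have hrevC : ((i.rev : ℕ) : ℂ) + 1 + (i : ℕ) = p := by exact_mod_cast hrev
  have hh : ((hParam p (p + m) : ℝ) : ℂ) = (2 * (p : ℂ) + m - 1) / 2 := by
    rw [hParam_add]; push_cast; ring
  have hcond : |s.re| < (α - (i.rev : ℕ)).re - ((m : ℝ) + 1) / 2 := by
    rw [hParam_add] at hα
    have : (0 : ℝ) ≤ (i : ℕ) := Nat.cast_nonneg _
    rw [Complex.sub_re, Complex.natCast_re]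
    linarith
  have key := integral_pow_mul_cpow_mul_jacobiFun m hcond
  rw [integral_Ici_eq_integral_Ioi]
  have e1 : α - (i.rev : ℕ) - ((m : ℂ) + 1) / 2 + s = α - hParam p (p + m) + s + i := by
    rw [hh]; linear_combination -hrevC
  have e2 : α - (i.rev : ℕ) - ((m : ℂ) + 1) / 2 - s = α - hParam p (p + m) - s + i := by
    rw [hh]; linear_combination -hrevC
  rw [e1, e2, mul_assoc (m.factorial : ℂ)] at key
  rw [← key]
  refine setIntegral_congr_fun measurableSet_Ioi fun x hx => ?_
  have hx0 : 0 < x := hx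
  have h1 : 0 < 1 + x := by linarith
  have hne : 1 + (x : ℂ) ≠ 0 :=
    Complex.slitPlane_ne_zero (one_add_ofReal_mem_slitPlane hx0.le)
  have hr : (((1 + x) ^ (((m : ℝ) + 1) / 2 - κ) : ℝ) : ℂ) *
      (((1 + x) ^ (κ - ((m : ℝ) + 1) / 2) : ℝ) : ℂ) = 1 := by
    rw [← Complex.ofReal_mul, ← Real.rpow_add h1]
    simp
  change spectralFun m κ x (-s ^ 2) * weightedMonomial m κ α i x = _
  rw [spectralFun_neg_sq, abs_of_pos hx0, weightedMonomial, rankOneWeight,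
    show -(α - ((i.rev : ℕ) : ℂ)) = -α + (i.rev : ℕ) by ring, Complex.cpow_add _ _ hne,
    Complex.cpow_natCast]
  linear_combination (jacobiFun m s x * (x : ℂ) ^ m * (1 + (x : ℂ)) ^ (-α) *
    (1 + (x : ℂ)) ^ (i.rev : ℕ)) * hr

lemma ascPochhammer_eval_add_mul_sub (u s : ℂ) (n : ℕ) :
    (ascPochhammer ℂ n).eval (u + s) * (ascPochhammer ℂ n).eval (u - s) =
      (∏ l ∈ Finset.range n, (Polynomial.X + Polynomial.C ((u + (l : ℂ)) ^ 2))).eval (-s ^ 2) := by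
  induction n with
  | zero => simp
  | succ n ih =>
    rw [Finset.prod_range_succ, Polynomial.eval_mul, ← ih, ascPochhammer_succ_eval,
      ascPochhammer_succ_eval]
    simp only [Polynomial.eval_add, Polynomial.eval_X, Polynomial.eval_C]
    ring

/-- Shifting both Gamma functions by `i` multiplies them by `∏_{l<i} ((u + l)² - s_j²)`, a monic
polynomial of degree `i` in `-s_j²`; such polynomials have the determinant of the monomials. -/
lemma det_Gamma_eq {p : ℕ} (u : ℂ) (c : Fin p → ℂ) (s : Fin p → ℂ)
    (h1 : ∀ j, 0 < (u + s j).re) (h2 : ∀ j, 0 < (u - s j).re) :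
    (Matrix.of fun i j : Fin p => c i * (Complex.Gamma (u + s j + (i : ℕ)) *
      Complex.Gamma (u - s j + (i : ℕ)))).det =
    (∏ i, c i) * (∏ j, Complex.Gamma (u + s j) * Complex.Gamma (u - s j)) *
      diffProd (fun k => s k ^ 2) := by
  set Q : Fin p → Polynomial ℂ := fun i =>
    ∏ l ∈ Finset.range (i : ℕ), (Polynomial.X + Polynomial.C ((u + (l : ℂ)) ^ 2)) with hQ
  have hmonic : ∀ i, (Q i).Monic := fun i =>
    Polynomial.monic_prod_of_monic _ _ fun l _ => Polynomial.monic_X_add_C _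
  have hdeg : ∀ i, (Q i).natDegree = i := by
    intro i
    rw [hQ, Polynomial.natDegree_prod_of_monic _ _ fun l _ => Polynomial.monic_X_add_C _]
    simp only [Polynomial.natDegree_X_add_C, Finset.sum_const, Finset.card_range, smul_eq_mul,
      mul_one]
  have hV := Matrix.det_eval_matrixOfPolynomials_eq_det_vandermonde (fun j => -s j ^ 2) Q hdeg hmonic
  have hentry : ∀ i j : Fin p, c i * (Complex.Gamma (u + s j + (i : ℕ)) *
      Complex.Gamma (u - s j + (i : ℕ))) =
      c i * ((Complex.Gamma (u + s j) * Complex.Gamma (u - s j)) * (Q i).eval (-s j ^ 2)) := by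
    intro i j
    rw [Gamma_add_natCast (h1 j), Gamma_add_natCast (h2 j), hQ, ← ascPochhammer_eval_add_mul_sub]
    ring
  simp only [hentry]
  have e1 := Matrix.det_mul_column c (Matrix.of fun i j : Fin p =>
    (Complex.Gamma (u + s j) * Complex.Gamma (u - s j)) * (Q i).eval (-s j ^ 2))
  have e2 := Matrix.det_mul_row (fun j => Complex.Gamma (u + s j) * Complex.Gamma (u - s j))
    (Matrix.of fun i j : Fin p => (Q i).eval (-s j ^ 2))
  simp only [Matrix.of_apply] at e1 e2
  rw [e1, e2, ← Matrix.det_transpose, diffProd_sq_eq_det_vandermonde, hV, mul_assoc]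
  rfl

/-- The right-hand side of the theorem. -/
noncomputable def gammaQuotient (p : ℕ) (u α : ℂ) (s : Fin p → ℂ) : ℂ :=
  (∏ k, Complex.Gamma (u + s k) * Complex.Gamma (u - s k)) /
    ∏ j ∈ Finset.range p, Complex.Gamma (α - j) ^ 2

/-- Multiplication by the Newton matrix turns divided differences back into values at the nodes. Its
determinant, the Vandermonde product, is non-zero by regularity and cancels. -/
lemma det_momentMatrix_of_regular {p : ℕ} (m : ℕ) {κ : ℝ} (hκ : 0 < κ) {α : ℂ}
    (hα : 0 < p → κ < α.re - hParam p (p + m)) {s : Fin p → ℂ} (hs : s ∈ tube p κ)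
    (hreg : diffProd (fun k => s k ^ 2) ≠ 0) :
    ((m.factorial : ℂ) ^ p)⁻¹ * (momentMatrix m κ α s).det =
      gammaQuotient p (α - hParam p (p + m)) α s := by
  obtain ⟨N, hN, hNf⟩ := exists_newton_matrix (fun j => -s j ^ 2) (a := spectralNodes s)
    (fun i => by simp [spectralNodes])
  have hmul : momentMatrix m κ α s * N = Matrix.of fun i j : Fin p =>
      (m.factorial / Complex.Gamma (α - (i.rev : ℕ)) ^ 2) *
        (Complex.Gamma (α - hParam p (p + m) + s j + (i : ℕ)) *
          Complex.Gamma (α - hParam p (p + m) - s j + (i : ℕ))) := by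
    ext i j
    rw [Matrix.of_apply, div_mul_eq_mul_div, ← integral_spectralFun_mul_weightedMonomial m (hα i.pos) (hs j),
      Matrix.mul_apply]
    simp only [momentMatrix, Matrix.of_apply, ← integral_mul_const]
    rw [← integral_finsetSum _ fun l _ =>
      (integrable_confluentFun_mul_weightedMonomial m hκ (hα i.pos) hs l i).mul_const _]
    refine integral_congr_ae (Filter.Eventually.of_forall fun x => ?_)
    change _ = spectralFun m κ x (-s j ^ 2) * weightedMonomial m κ α i x
    rw [hNf (spectralFun m κ x) j, Finset.sum_mul]
    refine Finset.sum_congr rfl fun l _ => ?_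
    rw [confluentFun]
    ring
  have hre : ∀ j, |(s j).re| < α.re - hParam p (p + m) := fun j => (hs j).trans (hα j.pos)
  have hdet := congrArg Matrix.det hmul
  rw [Matrix.det_mul, hN, ← diffProd_sq_eq_det_vandermonde, det_Gamma_eq
    (α - hParam p (p + m)) (fun i : Fin p => m.factorial / Complex.Gamma (α - (i.rev : ℕ)) ^ 2) s
    (fun j => by
      have := (abs_lt.mp (hre j)).1
      simp only [Complex.add_re, Complex.sub_re, Complex.ofReal_re]
      linarith)
    (fun j => by
      have := (abs_lt.mp (hre j)).2
      simp only [Complex.sub_re, Complex.ofReal_re]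
      linarith)] at hdet
  rw [mul_right_cancel₀ hreg hdet, gammaQuotient, Finset.prod_div_distrib, Finset.prod_const,
    Finset.card_univ, Fintype.card_fin, ← Fin.prod_univ_eq_prod_range
      (fun j => Complex.Gamma (α - (j : ℂ)) ^ 2),
    ← Equiv.prod_comp Fin.revPerm fun j : Fin p => Complex.Gamma (α - ((j : ℕ) : ℂ)) ^ 2]
  have : (m.factorial : ℂ) ≠ 0 := by exact_mod_cast m.factorial_ne_zero
  simp only [Fin.revPerm_apply]
  field_simp

lemma continuousAt_gammaQuotient {p : ℕ} {u : ℂ} (α : ℂ) {s₀ : Fin p → ℂ}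
    (h : ∀ k, |(s₀ k).re| < u.re) : ContinuousAt (gammaQuotient p u α) s₀ := by
  have hG : ∀ z : ℂ, 0 < z.re → ContinuousAt Complex.Gamma z := fun z hz =>
    (Complex.differentiableAt_Gamma z fun n hn => by
      have := add_natCast_ne_zero_of_re_pos hz n
      rw [hn] at this
      simp at this).continuousAt
  unfold gammaQuotient
  refine ContinuousAt.div_const (tendsto_finsetProd _ fun k _ => Filter.Tendsto.mul ?_ ?_) _
  · refine ContinuousAt.comp (f := fun s : Fin p → ℂ => u + s k) (g := Complex.Gamma)
      (hG _ ?_) (continuous_const.add (continuous_apply k)).continuousAt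
    rw [Complex.add_re]
    linarith [(abs_lt.mp (h k)).1]
  · refine ContinuousAt.comp (f := fun s : Fin p → ℂ => u - s k) (g := Complex.Gamma)
      (hG _ ?_) (continuous_const.sub (continuous_apply k)).continuousAt
    rw [Complex.sub_re]
    linarith [(abs_lt.mp (h k)).2]

/-- Both sides are continuous in `s`, and every point of the tube is a limit of regular ones. -/
lemma det_momentMatrix {p : ℕ} (m : ℕ) {κ : ℝ} (hκ : 0 < κ) {α : ℂ}
    (hα : 0 < p → κ < α.re - hParam p (p + m)) {s : Fin p → ℂ} (hs : s ∈ tube p κ) :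
    ((m.factorial : ℂ) ^ p)⁻¹ * (momentMatrix m κ α s).det =
      gammaQuotient p (α - hParam p (p + m)) α s := by
  have ht : Filter.Tendsto (fun t : ℂ => fun k : Fin p => s k + t * ((k : ℕ) + 1)) (𝓝[≠] 0)
      (𝓝 s) := by
    have h2 := (continuous_shift s).tendsto 0
    simp only [zero_mul, add_zero] at h2
    exact h2.mono_left nhdsWithin_le_nhds
  have h1 := ((continuousAt_det_momentMatrix m hκ hα hs).tendsto.comp ht).const_mul
    ((m.factorial : ℂ) ^ p)⁻¹
  have h2 := (continuousAt_gammaQuotient (u := α - hParam p (p + m)) α (s₀ := s) fun k => by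
    rw [Complex.sub_re, Complex.ofReal_re]
    exact (hs k).trans (hα k.pos)).tendsto.comp ht
  refine tendsto_nhds_unique h1 (h2.congr' ?_)
  filter_upwards [eventually_diffProd_sq_ne_zero s,
    ht.eventually ((isOpen_tube p κ).mem_nhds hs)] with t hreg htube
  exact (det_momentMatrix_of_regular m hκ hα htube hreg).symm

/-! ### Radial coordinates of a matrix in the ball -/

open scoped ComplexOrder in
lemma eigenvalues_mul_conjTranspose_lt_one {p q : ℕ} {z : Matrix (Fin p) (Fin q) ℂ}
    (hz : z ∈ ball p q) (j : Fin p) :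
    (Matrix.isHermitian_mul_conjTranspose_self z).eigenvalues j < 1 := by
  set hA := Matrix.isHermitian_mul_conjTranspose_self z
  set v : Fin p → ℂ := ⇑(hA.eigenvectorBasis j) with hv
  have hv0 : v ≠ 0 := by
    intro h
    have h1 := hA.eigenvectorBasis.toBasis.ne_zero j
    rw [OrthonormalBasis.coe_toBasis] at h1
    exact h1 (by ext i; exact congrFun h i)
  have hpos := hz.re_dotProduct_pos hv0
  have hmv : (1 - z * z.conjTranspose).mulVec v = (1 - hA.eigenvalues j : ℝ) • v := by
    rw [Matrix.sub_mulVec, Matrix.one_mulVec, hv, hA.mulVec_eigenvectorBasis j, sub_smul, one_smul]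
  rw [hmv, dotProduct_smul] at hpos
  have hvv : 0 ≤ RCLike.re (star v ⬝ᵥ v) := by
    have : 0 ≤ star v ⬝ᵥ v := dotProduct_star_self_nonneg v
    exact (RCLike.nonneg_iff.mp this).1
  by_contra hcon
  have : RCLike.re ((1 - hA.eigenvalues j : ℝ) • (star v ⬝ᵥ v)) =
      (1 - hA.eigenvalues j) * RCLike.re (star v ⬝ᵥ v) := RCLike.smul_re _ _
  rw [this] at hpos
  nlinarith

open scoped ComplexOrder in
lemma radialCoord_nonneg_and_det {p q : ℕ} (α : ℂ) {z : Matrix (Fin p) (Fin q) ℂ}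
    (hz : z ∈ ball p q) : (∀ j, 0 ≤ radialCoord z j) ∧
      Matrix.det (1 - z * z.conjTranspose) ^ α = berezinFunction p α (radialCoord z) := by
  set hA := Matrix.isHermitian_mul_conjTranspose_self z with hA'
  have hlt := eigenvalues_mul_conjTranspose_lt_one hz
  have hnn : ∀ j, 0 ≤ hA.eigenvalues j :=
    (Matrix.posSemidef_self_mul_conjTranspose z).eigenvalues_nonneg
  refine ⟨fun j => div_nonneg (hnn j) (by linarith [hlt j]), ?_⟩
  have hdet : Matrix.det (1 - z * z.conjTranspose) =
      ((∏ j, (1 - hA.eigenvalues j) : ℝ) : ℂ) := by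
    -- The determinant is the characteristic polynomial of `z z*` at `1`.
    have h1 := Matrix.eval_charpoly (z * z.conjTranspose) 1
    rw [map_one, hA.charpoly_eq, Polynomial.eval_prod] at h1
    rw [← h1]
    simp
  -- Complex powers are multiplicative here because the bases are non-negative reals.
  have hprod : ∀ S : Finset (Fin p), ((∏ j ∈ S, (1 - hA.eigenvalues j) : ℝ) : ℂ) ^ α =
      ∏ j ∈ S, ((1 - hA.eigenvalues j : ℝ) : ℂ) ^ α := by
    intro S
    induction S using Finset.induction_on with
    | empty => simp
    | insert a S ha ih =>
      rw [Finset.prod_insert ha, Finset.prod_insert ha, Complex.ofReal_mul,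
        Complex.mul_cpow_ofReal_nonneg (by linarith [hlt a])
          (Finset.prod_nonneg fun j _ => by linarith [hlt j]), ih]
  rw [hdet, hprod, berezinFunction]
  refine Finset.prod_congr rfl fun j _ => ?_
  have h0 : 0 < 1 - hA.eigenvalues j := by linarith [hlt j]
  have h1 : 1 + (radialCoord z j : ℂ) = (((1 - hA.eigenvalues j)⁻¹ : ℝ) : ℂ) := by
    rw [radialCoord, ← Complex.ofReal_one, ← Complex.ofReal_add]
    congr 1
    field_simp
    ring
  rw [h1, Complex.ofReal_inv, Complex.inv_cpow, ← Complex.cpow_neg, neg_neg]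
  rw [Complex.arg_ofReal_of_nonneg h0.le]
  exact Real.pi_pos.ne

end MatrixBall

/-! ### The theorem -/

theorem theorem6p13 (p q : ℕ) (hpq : p ≤ q) (α : ℂ) :
    (∀ z ∈ MatrixBall.ball p q,
      (∀ j, 0 ≤ MatrixBall.radialCoord z j) ∧
      Matrix.det (1 - z * z.conjTranspose) ^ α =
        MatrixBall.berezinFunction p α (MatrixBall.radialCoord z)) ∧
    ∀ s : Fin p → ℂ, (∀ k, |(s k).re| < α.re - MatrixBall.hParam p q) →
      IntegrableOn (MatrixBall.sphericalIntegrand p q (MatrixBall.berezinFunction p α) s)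
        (Set.Ici 0) ∧
      MatrixBall.sphericalTransform p q (MatrixBall.berezinFunction p α) s =
        (∏ k, Complex.Gamma (α - (MatrixBall.hParam p q : ℂ) + s k) *
            Complex.Gamma (α - (MatrixBall.hParam p q : ℂ) - s k)) /
          ∏ j ∈ Finset.range p, Complex.Gamma (α - j) ^ 2 := by
  refine ⟨fun z hz => MatrixBall.radialCoord_nonneg_and_det α hz, fun s hs => ?_⟩
  obtain ⟨m, rfl⟩ := Nat.exists_eq_add_of_le hpq
  -- For `p = 0` the hypothesis says nothing about `α`, and any positive `κ` will do.
  rcases Nat.eq_zero_or_pos p with rfl | hp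
  · obtain ⟨hint, heq⟩ := MatrixBall.sphericalTransform_eq_det (α := α) (s := s) m one_pos
      (fun h => absurd h (lt_irrefl 0)) fun k => k.elim0
    exact ⟨hint, heq.trans (MatrixBall.det_momentMatrix m one_pos
      (fun h => absurd h (lt_irrefl 0)) fun k => k.elim0)⟩
  have : Nonempty (Fin p) := ⟨⟨0, hp⟩⟩
  -- A single `κ` strictly between the largest `|Re s_k|` and `Re α - h` leaves room both for the
  -- tube to be open and for the integrals to converge.
  obtain ⟨k₀, hk₀⟩ := Finite.exists_max fun k => |(s k).re|
  obtain ⟨κ, h1, h2⟩ := exists_between (hs k₀)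
  have hκ : 0 < κ := (abs_nonneg _).trans_lt h1
  have htube : s ∈ MatrixBall.tube p κ := fun k => (hk₀ k).trans_lt h1
  obtain ⟨hint, heq⟩ := MatrixBall.sphericalTransform_eq_det m hκ (fun _ => h2) htube
  exact ⟨hint, heq.trans (MatrixBall.det_momentMatrix m hκ (fun _ => h2) htube)⟩
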